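/- **Problems.** *2-covariate fine-balance matching (BM) with at most $c$ levels in the second covariate* ($c$ a constant; this is the problem BM$'$). An instance consists of $n$ treatment samples, $n'$ control samples, a first covariate with an arbitrary number $k_1$ of levels, a second covariate with at most $c$ levels (each sample has one level of each covariate; levels may be empty), and non-negative integer distances $\delta_{ts}$ between treatment samples $t$ and control samples $s$. A feasible solution assigns to each treatment sample a control sample, distinct ones to distinct treatment samples, such that for each of the two covariates and each of its levels the number of selected control samples of that level equals the number of treatment samples of that level. The task is to output a feasible solution of minimum total distance, or to report that there is no feasible solution. *Bipartite exact matching.* An instance consists of an integer $k\ge 0$ and a bipartite graph with sides $V_1,V_2$, $|V_1|=|V_2|=q$, whose edge set is partitioned into red and blue edges. The task is to output a perfect matching with exactly $k$ blue edges, or to report that there is none. In both problems all numbers of the input (in particular the distances) are written in unary. A *deterministic polynomial-time algorithm* for such a problem is a deterministic Turing machine that outputs a correct answer on every instance within a number of steps polynomial in the length of the input. A *randomized polynomial-time algorithm with success probability at least $p$* is a probabilistic Turing machine (a fair coin toss in each step) that, on every instance and for all outcomes of the coin tosses, halts with an answer within a number of steps polynomial in the length of the input, and whose answer is correct with probability at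 least $p$. **Theorem.** Let $c\ge 2$ be a constant. 1. If there is a deterministic polynomial-time algorithm for 2-covariate BM with at most $c$ levels in the second covariate, then there is a deterministic polynomial-time algorithm for exact matching in bipartite graphs. 2. For every $p\in(0,1]$: if there is a randomized polynomial-time algorithm with success probability at least $p$ for 2-covariate BM with at most $c$ levels in the second covariate, then there is a randomized polynomial-time algorithm with success probability at least $p$ for exact matching in bipartite graphs. -/

import Mathlib

/-! ### Encodings over a finite alphabet -/

/-- Tape alphabet for inputs and outputs: a stroke, an end-of-number mark, an end-of-row mark. -/
inductive Letter : Type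
  | stroke
  | comma
  | semicolon
  deriving DecidableEq

instance : Fintype Letter where
  elems := {Letter.stroke, Letter.comma, Letter.semicolon}
  complete x := by cases x <;> simp

/-- A natural number in unary: `m` strokes followed by a comma. -/
def encodeNat (m : ℕ) : List Letter := List.replicate m Letter.stroke ++ [Letter.comma]

/-- A row of numbers, closed by a semicolon. -/
def encodeRow (row : List ℕ) : List Letter := row.flatMap encodeNat ++ [Letter.semicolon]

/-- A table is encoded row after row. -/
def encodeTable (table : List (List ℕ)) : List Letter := table.flatMap encodeRow

/-- The answer `none` ("no solution exists") is the empty word; a list is written as one row. -/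
def encodeAnswer : Option (List ℕ) → List Letter
  | none => []
  | some l => encodeRow l

/-! ### Search problems and polynomial-time algorithms -/

/-- A search problem: instances written as tables of numbers (in unary), and, for each instance, the
correct answers, an answer being a list of numbers or `none`. -/
structure SearchProblem where
  Inst : Type
  table : Inst → List (List ℕ)
  IsAnswer : Inst → Option (List ℕ) → Prop

/-- The input word of an instance. -/
def SearchProblem.input (P : SearchProblem) (x : P.Inst) : List Letter := encodeTable (P.table x)

/-- A deterministic Turing machine (with finitely many stacks as memory) writes a correct answer on
each instance, in time polynomial in the length of the input word. -/
def SearchProblem.HasDetPolyTimeAlgorithm (P : SearchProblem) : Prop :=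
  ∃ f : P.Inst → Option (List ℕ),
    (∀ x, P.IsAnswer x (f x)) ∧
      Nonempty (Turing.TM2ComputableInPolyTime P.input encodeAnswer f)

/-- A probabilistic Turing machine: a machine with two programs `m` and `m'`. In each step a fair
coin decides which of the two is applied. -/
structure ProbTM2 extends Turing.FinTM2 where
  m' : Λ → Turing.TM2.Stmt Γ Λ σ

/-- One step with a given result of the coin toss; a halted configuration stays as it is. -/
def ProbTM2.coinStep (M : ProbTM2) (cfg : M.toFinTM2.Cfg) (coin : Bool) : M.toFinTM2.Cfg :=
  Option.getD (α := Turing.TM2.Cfg M.Γ M.Λ M.σ)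
    (Turing.TM2.step (if coin then M.m' else M.m) cfg) cfg

/-- The configuration reached after consuming the given coin tosses, one per step. -/
def ProbTM2.run (M : ProbTM2) (coins : List Bool) (cfg : M.toFinTM2.Cfg) : M.toFinTM2.Cfg :=
  coins.foldl M.coinStep cfg

/-- A probabilistic Turing machine which, on each instance `x` and for every sequence `r` of coin
tosses, halts within polynomially many steps `T` with an answer `f r` on its output stack, and this
answer is correct with probability at least `p` over uniformly random `r ∈ {0,1}^T`. -/
def SearchProblem.HasRandPolyTimeAlgorithm (P : SearchProblem) (p : ℝ) : Prop :=
  ∃ (M : ProbTM2) (inAlph : M.Γ M.k₀ ≃ Letter) (outAlph : M.Γ M.k₁ ≃ Letter) (time : Polynomial ℕ),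
    ∀ x : P.Inst, ∃ f : (Fin (time.eval (P.input x).length) → Bool) → Option (List ℕ),
      (∀ r, M.run (List.ofFn r)
            (Turing.initList M.toFinTM2 ((P.input x).map inAlph.symm)) =
          Turing.haltList M.toFinTM2 ((encodeAnswer (f r)).map outAlph.symm)) ∧
        p ≤ ({r | P.IsAnswer x (f r)}.ncard : ℝ) / 2 ^ (time.eval (P.input x).length)

/-! ### Fine-balance matching with two covariates -/

/-- Instances of the 2-covariate problem in which the second covariate has (at most) `c` levels. The
treatment samples are `0, …, n - 1`, the control samples `0, …, n' - 1`. -/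
structure BMInstance (c : ℕ) where
  n : ℕ
  n' : ℕ
  k₁ : ℕ
  treatLevel₁ : Fin n → Fin k₁
  treatLevel₂ : Fin n → Fin c
  ctrlLevel₁ : Fin n' → Fin k₁
  ctrlLevel₂ : Fin n' → Fin c
  dist : Fin n → Fin n' → ℕ

namespace BMInstance

variable {c : ℕ} (I : BMInstance c)

/-- Fine balance of a selection `S` of treatment samples and a selection `S'` of control samples:
every level of every covariate contains equally many elements of both. -/
def FineBalance (S : Finset (Fin I.n)) (S' : Finset (Fin I.n')) : Prop :=
  (∀ i : Fin I.k₁,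
    (S.filter fun t => I.treatLevel₁ t = i).card = (S'.filter fun s => I.ctrlLevel₁ s = i).card) ∧
  (∀ i : Fin c,
    (S.filter fun t => I.treatLevel₂ t = i).card = (S'.filter fun s => I.ctrlLevel₂ s = i).card)

/-- An assignment of all treatment samples to distinct control samples such that the selection of
matched control samples is in fine balance with the whole treatment group. -/
def Feasible (a : Fin I.n → Fin I.n') : Prop :=
  Function.Injective a ∧ I.FineBalance Finset.univ (Finset.univ.image a)

/-- The total distance of an assignment. -/
def cost (a : Fin I.n → Fin I.n') : ℕ := ∑ t, I.dist t (a t)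

/-- A feasible assignment of minimum total distance. -/
def Optimal (a : Fin I.n → Fin I.n') : Prop :=
  I.Feasible a ∧ ∀ b, I.Feasible b → I.cost a ≤ I.cost b

/-- The number of levels of the first covariate, the levels of all samples, and the distance matrix
(one row for each treatment sample). -/
def table : List (List ℕ) :=
  [[I.k₁],
    List.ofFn fun t => (I.treatLevel₁ t : ℕ), List.ofFn fun t => (I.treatLevel₂ t : ℕ),
    List.ofFn fun s => (I.ctrlLevel₁ s : ℕ), List.ofFn fun s => (I.ctrlLevel₂ s : ℕ)] ++
  List.ofFn fun t => List.ofFn fun s => I.dist t s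

/-- An optimal assignment, given as the list of the matched control samples, or `none` if there is
no feasible assignment. -/
def IsAnswer : Option (List ℕ) → Prop
  | none => ∀ a, ¬ I.Feasible a
  | some l => ∃ a, I.Optimal a ∧ l = List.ofFn fun t => (a t : ℕ)

end BMInstance

/-- The 2-covariate fine-balance matching problem where the second covariate has at most `c` levels,
`c` being a constant. -/
def BMProblem (c : ℕ) : SearchProblem where
  Inst := BMInstance c
  table := BMInstance.table
  IsAnswer := BMInstance.IsAnswer

/-! ### Exact matching in bipartite graphs -/

inductive EdgeColor : Type
  | red
  | blue
  deriving DecidableEq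

/-- A bipartite graph with sides `V₁ = V₂ = {0, …, q - 1}` whose edges are red or blue
(`edge u v = none` if `u ∈ V₁` and `v ∈ V₂` are not adjacent), and the required number `k` of blue
edges. -/
structure ExactMatchingInstance where
  q : ℕ
  k : ℕ
  edge : Fin q → Fin q → Option EdgeColor

namespace ExactMatchingInstance

variable (I : ExactMatchingInstance)

/-- `a` matches each `u ∈ V₁` to `a u ∈ V₂`: a perfect matching with exactly `k` blue edges. -/
def IsExactMatching (a : Fin I.q → Fin I.q) : Prop :=
  Function.Bijective a ∧ (∀ u, I.edge u (a u) ≠ none) ∧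
    (Finset.univ.filter fun u => I.edge u (a u) = some EdgeColor.blue).card = I.k

/-- Matrix entry: `0` for no edge, `1` for a red edge, `2` for a blue edge. -/
def entry : Option EdgeColor → ℕ
  | none => 0
  | some EdgeColor.red => 1
  | some EdgeColor.blue => 2

/-- The number `k` and the coloured adjacency matrix. -/
def table : List (List ℕ) :=
  [I.k] :: List.ofFn fun u => List.ofFn fun v => entry (I.edge u v)

/-- A perfect matching with exactly `k` blue edges, given as the list of the partners of the nodes
of `V₁`, or `none` if there is no such matching. -/
def IsAnswer : Option (List ℕ) → Prop
  | none => ∀ a, ¬ I.IsExactMatching a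
  | some l => ∃ a, I.IsExactMatching a ∧ l = List.ofFn fun u => (a u : ℕ)

end ExactMatchingInstance

/-- The exact matching problem in bipartite graphs. -/
def ExactMatchingProblem : SearchProblem where
  Inst := ExactMatchingInstance
  table := ExactMatchingInstance.table
  IsAnswer := ExactMatchingInstance.IsAnswer

/-! The reduction makes a single call. From a coloured bipartite graph with sides of size `q` and a
number `k`, `bmInstance` takes the nodes of `V₁` as treatment samples and all pairs `(u, v)` as
control samples. The pair `(u, v)` has first level `v` and second level 1 if it is a blue edge, 0
otherwise. Treatment sample `t` has first level `t`, and the last `k` of them have second level 1.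
The distance from `t` to `(u, v)` is 0 if `u = t` and `uv` is an edge, and 1 otherwise. Balance in
the first covariate says that the selected columns form a bijection, and balance in the second that
exactly `k` selected pairs are blue. Cost 0 says that every `t` selects an edge at `t`. So for `k ≤
q` the feasible assignments of cost 0 are the perfect matchings with `k` blue edges. If `k > q`, if
nothing is feasible, or if the optimum is positive, there is no such matching
(`feasible_bmInstance_iff`, `exists_feasible`, `isAnswer_translate`). Only the levels 0 and 1 occur,
so any `c ≥ 2` will do.

The rest realises this on stack machines. A `Code` can be placed in any machine; `Run` says that it
does its work within `T` steps whatever the coins show, lengthening no stack by more than `T`.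
`composite` runs an encoder, then the given machine, then a decoder (`Exec.encodeInstance`,
`Exec.decodeAnswer`). The encoder ignores the coins, so the called machine sees a fixed window of
the coin sequence (`exists_run_composite`). Its input is no longer than the encoder's time bound,
and its answer is bounded through its running time (`exists_length_coinRun_le`), so the total time
is polynomial.

A fixed window of uniform coins is uniform, so the success probability is not diminished
(`ncard_comp_mem`). A deterministic machine is treated as a probabilistic one whose two programs
agree. -/

open Turing Turing.TM2 Function

/-! ### Programs for stack machines -/

namespace StackProgram

/-! ### Runs driven by coins, and growth of the stacks -/

section Steps

variable {K : Type} [DecidableEq K] {Γ : K → Type} {Λ σ : Type}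

/-- The configuration reached when in each step a coin decides which program is applied; a halted
configuration stays as it is. -/
def coinRun (m : Bool → Λ → Stmt Γ Λ σ) (coins : List Bool) (c : Cfg Γ Λ σ) : Cfg Γ Λ σ :=
  coins.foldl (fun c b => (step (m b) c).getD c) c

@[simp] theorem coinRun_nil (m : Bool → Λ → Stmt Γ Λ σ) (c : Cfg Γ Λ σ) : coinRun m [] c = c := rfl

@[simp] theorem coinRun_cons (m : Bool → Λ → Stmt Γ Λ σ) (b : Bool) (coins : List Bool)
    (c : Cfg Γ Λ σ) : coinRun m (b :: coins) c = coinRun m coins ((step (m b) c).getD c) := rfl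

theorem coinRun_append (m : Bool → Λ → Stmt Γ Λ σ) (l l' : List Bool) (c : Cfg Γ Λ σ) :
    coinRun m (l ++ l') c = coinRun m l' (coinRun m l c) := by
  simp [coinRun]

theorem coinRun_halted (m : Bool → Λ → Stmt Γ Λ σ) (coins : List Bool) (c : Cfg Γ Λ σ)
    (h : c.l = none) : coinRun m coins c = c := by
  induction coins with
  | nil => rfl
  | cons b coins ih =>
    obtain ⟨l, v, S⟩ := c
    obtain rfl : l = none := h
    simpa using ih

/-- After exactly `t` steps, the configuration `c` becomes `c'`, whatever the coins are. -/
def Reach (m : Bool → Λ → Stmt Γ Λ σ) (t : ℕ) (c c' : Cfg Γ Λ σ) : Prop :=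
  ∀ coins : List Bool, coins.length = t → coinRun m coins c = c'

theorem Reach.single {m : Bool → Λ → Stmt Γ Λ σ} {l : Λ} {v : σ} {S : ∀ k, List (Γ k)}
    {c' : Cfg Γ Λ σ} (h : ∀ b, stepAux (m b l) v S = c') : Reach m 1 ⟨some l, v, S⟩ c' := by
  intro coins hc
  obtain ⟨b, rfl⟩ := List.length_eq_one_iff.1 hc
  simp [h b]

theorem Reach.trans {m : Bool → Λ → Stmt Γ Λ σ} {t t' : ℕ} {c c' c'' : Cfg Γ Λ σ}
    (h : Reach m t c c') (h' : Reach m t' c' c'') : Reach m (t + t') c c'' := by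
  intro coins hc
  rw [← List.take_append_drop t coins, coinRun_append, h _ (by simp [hc]), h' _ (by simp [hc])]

/-- The number of push instructions in a statement. -/
def pushes : Stmt Γ Λ σ → ℕ
  | .push _ _ q => pushes q + 1
  | .peek _ _ q => pushes q
  | .pop _ _ q => pushes q
  | .load _ q => pushes q
  | .branch _ q q' => pushes q + pushes q'
  | .goto _ => 0
  | .halt => 0

/-- Only `push` lengthens a stack. For a branch `pushes` adds both alternatives, an overestimate
that is good enough for a constant bound. -/
theorem length_stepAux_le (q : Stmt Γ Λ σ) (v : σ) (S : ∀ k, List (Γ k)) (k : K) :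
    ((stepAux q v S).stk k).length ≤ (S k).length + pushes q := by
  induction q generalizing v S with
  | push k' f q ih =>
    refine (ih _ _).trans ?_
    by_cases h : k = k'
    · subst h; simp only [update_self, List.length_cons, pushes]; omega
    · simp only [ne_eq, h, not_false_eq_true, update_of_ne, pushes]; omega
  | peek k' f q ih => exact ih _ _
  | pop k' f q ih =>
    refine (ih _ _).trans ?_
    by_cases h : k = k'
    · subst h; simp [pushes]
    · simp [h, pushes]
  | load f q ih => exact ih _ _
  | branch f q q' ih ih' =>
    simp only [stepAux, pushes]
    have := ih v S
    have := ih' v S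
    cases f v <;> simp only [cond] <;> omega
  | goto f => simp
  | halt => simp

/-- In `t` steps a machine lengthens a stack by at most a constant times `t`. -/
theorem exists_length_coinRun_le [Finite Λ] (m : Bool → Λ → Stmt Γ Λ σ) :
    ∃ C : ℕ, ∀ coins c k,
      ((coinRun m coins c).stk k).length ≤ (c.stk k).length + C * coins.length := by
  obtain ⟨C, hC⟩ := (Set.finite_range fun bl : Bool × Λ => pushes (m bl.1 bl.2)).bddAbove
  refine ⟨C, fun coins => ?_⟩
  induction coins with
  | nil => intro c k; simp
  | cons b coins ih =>
    intro c k
    refine (ih _ k).trans ?_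
    have : (((step (m b) c).getD c).stk k).length ≤ (c.stk k).length + C := by
      obtain ⟨l, v, S⟩ := c
      cases l with
      | none => simp
      | some l => exact (length_stepAux_le _ _ _ _).trans (Nat.add_le_add_left (hC ⟨(b, l), rfl⟩) _)
    simp only [List.length_cons, Nat.mul_add]
    omega

end Steps

/-! ### Relocatable pieces of program and their specifications -/

variable {K : Type} {Γ : K → Type} {τ : Type}

/-- A piece of program: finitely many labels, and instructions for them which can be placed into any
machine, given the positions of its labels and the label at which to continue at the end. A
component `τ` of the internal state is left alone. -/
structure Code (Γ : K → Type) (τ : Type) where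
  Λ : Type
  [fin : Fintype Λ]
  start : Λ
  code : ∀ {L : Type}, (Λ → L) → L → Λ → Stmt Γ L (τ × L)

attribute [instance] Code.fin

namespace Code

/-- Do nothing. -/
def skip : Code Γ τ where
  Λ := Unit
  start := ()
  code _ exit _ := .goto fun _ => exit

/-- Push a letter. -/
def push (k : K) (a : Γ k) : Code Γ τ where
  Λ := Unit
  start := ()
  code _ exit _ := .push k (fun _ => a) (.goto fun _ => exit)

/-- One program after another. -/
def seq (p q : Code Γ τ) : Code Γ τ where
  Λ := p.Λ ⊕ q.Λ
  start := .inl p.start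
  code e exit
    | .inl l => p.code (fun l => e (.inl l)) (e (.inr q.start)) l
    | .inr l => q.code (fun l => e (.inr l)) exit l

/-- Pop a letter and continue depending on it. -/
def popCase (k : K) [Fintype (Γ k)] (p : Code Γ τ) (q : Γ k → Code Γ τ) : Code Γ τ where
  Λ := Option (p.Λ ⊕ Σ a, (q a).Λ)
  start := none
  code e exit
    | none => .pop k
        (fun v x => (v.1, x.elim (e (some (.inl p.start))) fun a => e (some (.inr ⟨a, (q a).start⟩))))
        (.goto fun v => v.2)
    | some (.inl l) => p.code (fun l => e (some (.inl l))) exit l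
    | some (.inr ⟨a, l⟩) => (q a).code (fun l => e (some (.inr ⟨a, l⟩))) exit l

/-- Pop letters and run the body for each of them, until the stack is empty or a letter satisfying
`final` has been popped. -/
def loop (k : K) [Fintype (Γ k)] (final : Γ k → Bool) (body : Γ k → Code Γ τ) : Code Γ τ where
  Λ := Option (Σ a, (body a).Λ)
  start := none
  code e exit
    | none => .pop k
        (fun v x => (v.1, x.elim exit fun a => bif final a then exit else e (some ⟨a, (body a).start⟩)))
        (.goto fun v => v.2)
    | some ⟨a, l⟩ => (body a).code (fun l => e (some ⟨a, l⟩)) (e none) l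

end Code

variable [DecidableEq K]

/-- The program `p` turns the stacks `S` into `S'` within `T` steps. -/
def Run (p : Code Γ τ) (S S' : ∀ k, List (Γ k)) (T : ℕ) : Prop :=
  (∀ k, (S' k).length ≤ (S k).length + T) ∧
  ∀ {L : Type} (m : Bool → L → Stmt Γ L (τ × L)) (e : p.Λ → L) (exit : L),
    (∀ b l, m b (e l) = p.code e exit l) →
    ∀ v w, ∃ t ≤ T, ∃ w', Reach m t ⟨some (e p.start), (v, w), S⟩ ⟨some exit, (v, w'), S'⟩

namespace Run

variable {p q : Code Γ τ} {S S' S'' : ∀ k, List (Γ k)} {T T' : ℕ}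

theorem mono (h : Run p S S' T) (hT : T ≤ T') : Run p S S' T' := by
  refine ⟨fun k => (h.1 k).trans (by omega), fun m e exit he v w => ?_⟩
  obtain ⟨t, ht, h⟩ := h.2 m e exit he v w
  exact ⟨t, ht.trans hT, h⟩

theorem skip (S : ∀ k, List (Γ k)) : Run (Code.skip : Code Γ τ) S S 1 :=
  ⟨fun k => by omega, fun m e exit he v w =>
    ⟨1, le_rfl, w, Reach.single fun b => by rw [he]; rfl⟩⟩

theorem push (S : ∀ k, List (Γ k)) (k : K) (a : Γ k) :
    Run (Code.push k a : Code Γ τ) S (update S k (a :: S k)) 1 := by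
  refine ⟨fun k' => ?_, fun m e exit he v w =>
    ⟨1, le_rfl, w, Reach.single fun b => by rw [he]; rfl⟩⟩
  by_cases h : k' = k
  · subst h; simp
  · simp [h]

theorem seq (h : Run p S S' T) (h' : Run q S' S'' T') : Run (p.seq q) S S'' (T + T') := by
  refine ⟨fun k => by have := h.1 k; have := h'.1 k; omega, fun m e exit he v w => ?_⟩
  obtain ⟨t, ht, w', h⟩ := h.2 m (fun l => e (.inl l)) (e (.inr q.start)) (fun b l => he b _) v w
  obtain ⟨t', ht', w'', h'⟩ := h'.2 m (fun l => e (.inr l)) exit (fun b l => he b _) v w'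
  exact ⟨t + t', by omega, w'', h.trans h'⟩

section

variable {k : K} [Fintype (Γ k)] {a : Γ k} {l : List (Γ k)}

/-- A `pop` can only update the internal state. So the label of the chosen branch is stored in the
second state component and the `goto` of the same step reads it, at the price of one step. -/
theorem popCase_nil {r : Γ k → Code Γ τ} (hS : S k = []) (h : Run p S S' T) :
    Run (Code.popCase k p r) S S' (T + 1) := by
  refine ⟨fun k => by have := h.1 k; omega, fun m e exit he v w => ?_⟩
  obtain ⟨t, ht, w', h⟩ := h.2 m (fun l => e (some (.inl l))) exit (fun b l => he b _) v
    (e (some (.inl p.start)))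
  refine ⟨1 + t, by omega, w', Reach.trans (Reach.single fun b => ?_) h⟩
  have : update S k [] = S := by rw [← hS, update_eq_self]
  rw [he]
  simp [Code.popCase, hS, this]

theorem length_update_le (hS : S k = a :: l) (k' : K) :
    (update S k l k').length ≤ (S k').length := by
  by_cases h : k' = k
  · subst h; simp [hS]
  · simp [h]

theorem popCase_cons {r : Γ k → Code Γ τ} (hS : S k = a :: l) (h : Run (r a) (update S k l) S' T) :
    Run (Code.popCase k p r) S S' (T + 1) := by
  refine ⟨fun k' => ?_, fun m e exit he v w => ?_⟩
  · have := h.1 k'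
    have := length_update_le hS k'
    omega
  obtain ⟨t, ht, w', h⟩ := h.2 m (fun l => e (some (.inr ⟨a, l⟩))) exit (fun b l => he b _) v
    (e (some (.inr ⟨a, (r a).start⟩)))
  refine ⟨1 + t, by omega, w', Reach.trans (Reach.single fun b => ?_) h⟩
  rw [he]
  simp [Code.popCase, hS]

variable {final : Γ k → Bool} {body : Γ k → Code Γ τ}

theorem loop_nil (hS : S k = []) : Run (Code.loop k final body) S S 1 := by
  refine ⟨fun k' => by omega, fun m e exit he v w =>
    ⟨1, le_rfl, exit, Reach.single fun b => ?_⟩⟩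
  have : update S k [] = S := by rw [← hS, update_eq_self]
  rw [he]
  simp [Code.loop, hS, this]

theorem loop_stop (hS : S k = a :: l) (ha : final a = true) :
    Run (Code.loop k final body) S (update S k l) 1 := by
  refine ⟨fun k' => by have := length_update_le hS k'; omega, fun m e exit he v w =>
    ⟨1, le_rfl, exit, Reach.single fun b => ?_⟩⟩
  rw [he]
  simp [Code.loop, hS, ha]

/-- The exit label of the body is the head of the loop, so the remaining rounds are again a run of
the same loop, placed at the same labels. -/
theorem loop_cons (hS : S k = a :: l) (ha : final a = false)
    (h : Run (body a) (update S k l) S' T) (h' : Run (Code.loop k final body) S' S'' T') :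
    Run (Code.loop k final body) S S'' (T + T' + 1) := by
  refine ⟨fun k' => ?_, fun m e exit he v w => ?_⟩
  · have := h.1 k'
    have := h'.1 k'
    have := length_update_le hS k'
    omega
  obtain ⟨t, ht, w', h⟩ := h.2 m (fun l => e (some ⟨a, l⟩)) (e none) (fun b l => he b _) v
    (e (some ⟨a, (body a).start⟩))
  obtain ⟨t', ht', w'', h'⟩ := h'.2 m e exit he v w'
  refine ⟨1 + t + t', by omega, w'', Reach.trans (Reach.trans (Reach.single fun b => ?_) h) h'⟩
  rw [he]
  simp [Code.loop, hS, ha]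

end

end Run

end StackProgram

namespace StackProgram

/-! ### A machine with a call of another machine -/

section Merge

variable {W K : Type} [DecidableEq W] [DecidableEq K] {A : W → Type} {B : K → Type}

/-- The alphabets of stacks indexed by a sum type. -/
abbrev SumAlph {W K : Type} (A : W → Type) (B : K → Type) : W ⊕ K → Type
  | .inl w => A w
  | .inr k => B k

/-- Stacks indexed by a sum type. -/
def merge (S : ∀ w, List (A w)) (S' : ∀ k, List (B k)) : ∀ k, List (SumAlph A B k)
  | .inl w => S w
  | .inr k => S' k

/-- All stacks except one are empty. -/
def single (k : K) (l : List (B k)) : ∀ k, List (B k) := update (fun _ => []) k l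

theorem update_merge_inl (S : ∀ w, List (A w)) (S' : ∀ k, List (B k)) (w : W) (l : List (A w)) :
    update (merge S S') (.inl w) l = merge (update S w l) S' := by
  refine update_eq_iff.2 ⟨(update_self w l S).symm, ?_⟩
  rintro (w' | k) h
  · exact (update_of_ne (fun h' => h (congrArg _ h')) l S).symm
  · rfl

theorem update_merge_inr (S : ∀ w, List (A w)) (S' : ∀ k, List (B k)) (k : K) (l : List (B k)) :
    update (merge S S') (.inr k) l = merge S (update S' k l) := by
  refine update_eq_iff.2 ⟨(update_self k l S').symm, ?_⟩
  rintro (w | k') h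
  · rfl
  · exact (update_of_ne (fun h' => h (congrArg _ h')) l S').symm

end Merge

theorem initList_eq (tm : FinTM2) (s : List (tm.Γ tm.k₀)) :
    initList tm s = ⟨some tm.main, tm.initialState, single tm.k₀ s⟩ := by
  unfold initList single
  congr 1
  funext k
  by_cases h : k = tm.k₀
  · subst h; simp
  · simp [h]

theorem haltList_eq (tm : FinTM2) (s : List (tm.Γ tm.k₁)) :
    haltList tm s = ⟨none, tm.initialState, single tm.k₁ s⟩ := by
  unfold haltList single
  congr 1
  funext k
  by_cases h : k = tm.k₁
  · subst h; simp
  · simp [h]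

section Call

variable {W K : Type} [DecidableEq W] [DecidableEq K] (A : W → Type) {B : K → Type} {Λ σ L : Type}

/-- A statement of a machine as a statement of a larger machine, which continues at the label `exit`
where the original machine halts. -/
def embedStmt (e : Λ → L) (exit : L) : Stmt B Λ σ → Stmt (SumAlph A B) L (σ × L)
  | .push k f q => .push (.inr k) (fun v => f v.1) (embedStmt e exit q)
  | .peek k f q => .peek (.inr k) (fun v x => (f v.1 x, v.2)) (embedStmt e exit q)
  | .pop k f q => .pop (.inr k) (fun v x => (f v.1 x, v.2)) (embedStmt e exit q)
  | .load f q => .load (fun v => (f v.1, v.2)) (embedStmt e exit q)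
  | .branch f q q' => .branch (fun v => f v.1) (embedStmt e exit q) (embedStmt e exit q')
  | .goto f => .goto fun v => e (f v.1)
  | .halt => .goto fun _ => exit

variable {A}

/-- A configuration of a machine as a configuration of a larger machine. -/
def embedCfg (e : Λ → L) (exit w : L) (S : ∀ w, List (A w)) (c : Cfg B Λ σ) :
    Cfg (SumAlph A B) L (σ × L) :=
  ⟨some (c.l.elim exit e), (c.var, w), merge S c.stk⟩

/-- One step is simulated by exactly one step: halting becomes a jump inside the same statement, so
coins stay aligned with steps. -/
theorem stepAux_embedStmt (e : Λ → L) (exit w : L) (S : ∀ w, List (A w)) (q : Stmt B Λ σ) (v : σ)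
    (S' : ∀ k, List (B k)) :
    stepAux (embedStmt A e exit q) (v, w) (merge S S') = embedCfg e exit w S (stepAux q v S') := by
  induction q generalizing v S' with
  | push k f q ih =>
    exact (congrArg (stepAux _ _) (update_merge_inr ..)).trans (ih _ _)
  | peek k f q ih => exact ih _ _
  | pop k f q ih =>
    exact (congrArg (stepAux _ _) (update_merge_inr ..)).trans (ih _ _)
  | load f q ih => exact ih _ _
  | branch f q q' ih ih' =>
    rw [embedStmt, stepAux, stepAux]
    cases f v
    · exact ih' _ _
    · exact ih _ _
  | goto f => rfl
  | halt => rfl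

/-- The called machine may halt before its coins are used up, at a time depending on them. The
larger machine then moves on at once, so the simulation consumes only a prefix of length `j`. -/
theorem exists_coinRun_embedCfg {m : Bool → Λ → Stmt B Λ σ}
    {m' : Bool → L → Stmt (SumAlph A B) L (σ × L)} {e : Λ → L} {exit : L}
    (he : ∀ b l, m' b (e l) = embedStmt A e exit (m b l)) (w : L) (S : ∀ w, List (A w))
    (coins : List Bool) (c : Cfg B Λ σ) (h : (coinRun m coins c).l = none) :
    ∃ j ≤ coins.length,
      coinRun m' (coins.take j) (embedCfg e exit w S c) =
        embedCfg e exit w S (coinRun m coins c) := by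
  induction coins generalizing c with
  | nil => exact ⟨0, le_rfl, rfl⟩
  | cons b coins ih =>
    obtain ⟨l, v, S'⟩ := c
    cases l with
    | none => exact ⟨0, by simp, by rw [coinRun_halted m _ _ rfl]; rfl⟩
    | some l =>
      obtain ⟨j, hj, h⟩ := ih _ h
      refine ⟨j + 1, by simpa using hj, ?_⟩
      rw [List.take_succ_cons, coinRun_cons, coinRun_cons, ← h]
      congr 1
      simp only [embedCfg, Option.elim, step, Option.getD_some, he]
      exact stepAux_embedStmt ..

end Call

/-! ### Encoder, called machine and decoder in one machine -/

section Composite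

/-- The two programs of a probabilistic machine. -/
def programs (M : ProbTM2) (b : Bool) : M.Λ → Stmt M.Γ M.Λ M.σ := if b then M.m' else M.m

theorem run_eq_coinRun (M : ProbTM2) (coins : List Bool) (c : M.toFinTM2.Cfg) :
    M.run coins c = coinRun (programs M) coins c := rfl

variable (M : ProbTM2) {W : Type} [DecidableEq W] [Fintype W] {A : W → Type} (w₀ w₁ : W)
  [Fintype (A w₀)] (pre post : Code (SumAlph A M.Γ) M.σ)

/-- The programs of a machine which runs `pre`, then the machine `M`, then `post`. -/
def compositeProgram (b : Bool) :
    pre.Λ ⊕ M.Λ ⊕ post.Λ ⊕ Unit →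
      Stmt (SumAlph A M.Γ) (pre.Λ ⊕ M.Λ ⊕ post.Λ ⊕ Unit) (M.σ × (pre.Λ ⊕ M.Λ ⊕ post.Λ ⊕ Unit))
  | .inl l => pre.code .inl (.inr (.inl M.main)) l
  | .inr (.inl l) =>
    embedStmt A (fun l => .inr (.inl l)) (.inr (.inr (.inl post.start))) (programs M b l)
  | .inr (.inr (.inl l)) => post.code (fun l => .inr (.inr (.inl l))) (.inr (.inr (.inr ()))) l
  | .inr (.inr (.inr ())) => .load (fun v => (v.1, .inl pre.start)) .halt

/-- The machine which runs `pre`, then the machine `M`, then `post`. -/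
def composite : ProbTM2 where
  K := W ⊕ M.K
  kFin := letI := M.kFin; inferInstance
  k₀ := .inl w₀
  k₁ := .inl w₁
  Γ := SumAlph A M.Γ
  Λ := pre.Λ ⊕ M.Λ ⊕ post.Λ ⊕ Unit
  main := .inl pre.start
  ΛFin := letI := M.ΛFin; inferInstance
  σ := M.σ × (pre.Λ ⊕ M.Λ ⊕ post.Λ ⊕ Unit)
  initialState := (M.initialState, .inl pre.start)
  σFin := letI := M.ΛFin; letI := M.σFin; inferInstance
  Γk₀Fin := inferInstanceAs (Fintype (A w₀))
  m := compositeProgram M pre post false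
  m' := compositeProgram M pre post true

theorem composite_m'_eq (h : M.m' = M.m) :
    (composite M w₀ w₁ pre post).m' = (composite M w₀ w₁ pre post).m := by
  show compositeProgram M pre post true = compositeProgram M pre post false
  funext l
  rcases l with l | l | l | l
  · rfl
  · simp [compositeProgram, programs, h]
  · rfl
  · rfl

variable {M w₀ w₁ pre post}

/-- The time `t` of the encoder is fixed before the coins are chosen, so the called machine always
reads the coins from position `t`. Coins it leaves unused go to the decoder, which ignores them, and
surplus coins meet a halted configuration. -/
theorem exists_run_composite {S : ∀ w, List (A w)} {inp : List (A w₀)} {inp' : List (M.Γ M.k₀)}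
    {ans : List Bool → List (M.Γ M.k₁)} {out : List Bool → List (A w₁)} {T₁ T T₂ : ℕ}
    (hpre : Run pre (merge (single w₀ inp) fun _ => []) (merge S (single M.k₀ inp')) T₁)
    (hM : ∀ coins : List Bool, coins.length = T →
      M.run coins (initList M.toFinTM2 inp') = haltList M.toFinTM2 (ans coins))
    (hpost : ∀ coins : List Bool, coins.length = T →
      Run post (merge S (single M.k₁ (ans coins))) (merge (single w₁ (out coins)) fun _ => []) T₂) :
    ∃ t ≤ T₁, ∀ coins : List Bool, T₁ + T + T₂ + 1 ≤ coins.length →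
      (composite M w₀ w₁ pre post).run coins (initList (composite M w₀ w₁ pre post).toFinTM2 inp) =
        haltList (composite M w₀ w₁ pre post).toFinTM2 (out ((coins.drop t).take T)) := by
  let m := compositeProgram M pre post
  obtain ⟨t, ht, w, h₁⟩ := hpre.2 m .inl (.inr (.inl M.main)) (fun b l => rfl) M.initialState
    (.inl pre.start)
  refine ⟨t, ht, fun coins hc => ?_⟩
  set r := (coins.drop t).take T with hr
  have hrl : r.length = T := by simp [hr]; omega
  have hM' : coinRun (programs M) r ⟨some M.main, M.initialState, single M.k₀ inp'⟩ =
      ⟨none, M.initialState, single M.k₁ (ans r)⟩ := by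
    have := hM r hrl
    rw [initList_eq, haltList_eq] at this
    exact this
  obtain ⟨j, hj, h₂⟩ := exists_coinRun_embedCfg (m' := m) (e := fun l => .inr (.inl l))
    (exit := .inr (.inr (.inl post.start))) (fun b l => rfl) w S r _ (by rw [hM'])
  rw [hM'] at h₂
  obtain ⟨t', ht', w', h₃⟩ := (hpost r hrl).2 m (fun l => .inr (.inr (.inl l)))
    (.inr (.inr (.inr ()))) (fun b l => rfl) M.initialState w
  -- `haltList` requires the initial internal state, so the last step resets the label register. The
  -- other component was already restored when the called machine halted.
  have h₄ : Reach m 1 ⟨some (.inr (.inr (.inr ()))), (M.initialState, w'),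
      merge (single w₁ (out r)) fun _ => []⟩
      ⟨none, (M.initialState, .inl pre.start), merge (single w₁ (out r)) fun _ => []⟩ :=
    Reach.single fun b => rfl
  have h₃₄ := h₃.trans h₄
  have hprog : programs (composite M w₀ w₁ pre post) = m := by
    funext b; cases b <;> rfl
  have hs₀ : single (B := SumAlph A M.Γ) (Sum.inl w₀) inp = merge (single w₀ inp) fun _ => [] := by
    unfold single
    rw [← update_merge_inl]
    congr 1
    funext k; cases k <;> rfl
  have hs₁ : single (B := SumAlph A M.Γ) (Sum.inl w₁) (out r) =
      merge (single w₁ (out r)) fun _ => [] := by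
    unfold single
    rw [← update_merge_inl]
    congr 1
    funext k; cases k <;> rfl
  refine (congrArg _ (initList_eq _ _)).trans (Eq.trans ?_ (haltList_eq _ _).symm)
  refine (run_eq_coinRun _ _ _).trans ?_
  rw [hprog]
  show coinRun m coins ⟨some (.inl pre.start), (M.initialState, .inl pre.start),
    single (B := SumAlph A M.Γ) (.inl w₀) inp⟩ = ⟨none, (M.initialState, .inl pre.start),
    single (B := SumAlph A M.Γ) (.inl w₁) (out r)⟩
  rw [hs₀, hs₁]
  rw [hrl] at hj
  -- Since `j ≤ T`, the coins consumed by the simulation form a prefix of everything after position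
  -- `t`.
  have htake : r.take j = (coins.drop t).take j := by simp [hr, List.take_take, hj]
  rw [htake] at h₂
  rw [← List.take_append_drop t coins, ← List.take_append_drop j (coins.drop t),
    ← List.take_append_drop (t' + 1) ((coins.drop t).drop j), coinRun_append, coinRun_append,
    coinRun_append, h₁ (coins.take t) (by simp; omega)]
  refine Eq.trans (congrArg (coinRun m _) (congrArg (coinRun m _) h₂)) ?_
  refine Eq.trans (congrArg (coinRun m _)
    (h₃₄ (((coins.drop t).drop j).take (t' + 1)) (by simp; omega))) ?_
  rw [coinRun_halted _ _ _ rfl]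

end Composite

end StackProgram

namespace StackProgram

/-! ### Memory of the reduction -/

/-- Stacks which serve as counters. -/
inductive Counter : Type
  | excess | outer | outer' | inner | inner' | high | low | temp
  deriving DecidableEq

instance : Fintype Counter where
  elems := {.excess, .outer, .outer', .inner, .inner', .high, .low, .temp}
  complete c := by cases c <;> simp

/-- Stacks which hold words; `port` is a stack of the machine that is called. -/
inductive Tape : Type
  | inp | out | colors | result | matrix | diag | port
  deriving DecidableEq

instance : Fintype Tape where
  elems := {.inp, .out, .colors, .result, .matrix, .diag, .port}
  complete t := by cases t <;> simp

/-- The letters on a tape. On `matrix`, an entry tells whether there is an edge, and `none` ends a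
row. On `diag`, `none` ends a row, `some none` is an entry off the diagonal block. -/
abbrev Tape.Alph : Tape → Type
  | matrix => Option Bool
  | diag => Option (Option Bool)
  | _ => Letter

instance (t : Tape) : Fintype t.Alph := by
  cases t <;> dsimp only [Tape.Alph] <;> infer_instance

/-- The letters on the stacks of the reduction. -/
abbrev Alph : Counter ⊕ Tape → Type
  | .inl _ => Unit
  | .inr t => t.Alph

/-- The contents of all stacks. -/
structure Mem where
  excess : ℕ := 0
  outer : ℕ := 0
  outer' : ℕ := 0
  inner : ℕ := 0
  inner' : ℕ := 0
  high : ℕ := 0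
  low : ℕ := 0
  temp : ℕ := 0
  inp : List Letter := []
  out : List Letter := []
  colors : List Letter := []
  result : List Letter := []
  matrix : List (Option Bool) := []
  diag : List (Option (Option Bool)) := []
  port : List Letter := []

namespace Mem

def count (s : Mem) : Counter → ℕ
  | .excess => s.excess
  | .outer => s.outer
  | .outer' => s.outer'
  | .inner => s.inner
  | .inner' => s.inner'
  | .high => s.high
  | .low => s.low
  | .temp => s.temp

def setCount (s : Mem) (n : ℕ) : Counter → Mem
  | .excess => { s with excess := n }
  | .outer => { s with outer := n }
  | .outer' => { s with outer' := n }
  | .inner => { s with inner := n }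
  | .inner' => { s with inner' := n }
  | .high => { s with high := n }
  | .low => { s with low := n }
  | .temp => { s with temp := n }

def word (s : Mem) : (t : Tape) → List t.Alph
  | .inp => s.inp
  | .out => s.out
  | .colors => s.colors
  | .result => s.result
  | .matrix => s.matrix
  | .diag => s.diag
  | .port => s.port

def setWord (s : Mem) : (t : Tape) → List t.Alph → Mem
  | .inp, l => { s with inp := l }
  | .out, l => { s with out := l }
  | .colors, l => { s with colors := l }
  | .result, l => { s with result := l }
  | .matrix, l => { s with matrix := l }
  | .diag, l => { s with diag := l }
  | .port, l => { s with port := l }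

@[simp] theorem count_setCount (s : Mem) (n : ℕ) (c : Counter) : (s.setCount n c).count c = n := by
  cases c <;> rfl

theorem count_setCount_of_ne (s : Mem) (n : ℕ) {c c' : Counter} (h : c ≠ c') :
    (s.setCount n c).count c' = s.count c' := by
  cases c <;> cases c' <;> first | rfl | exact absurd rfl h

@[simp] theorem setCount_setCount (s : Mem) (n n' : ℕ) (c : Counter) :
    (s.setCount n c).setCount n' c = s.setCount n' c := by
  cases c <;> rfl

theorem setCount_comm (s : Mem) (n n' : ℕ) {c c' : Counter} (h : c ≠ c') :
    (s.setCount n c).setCount n' c' = (s.setCount n' c').setCount n c := by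
  cases c <;> cases c' <;> first | rfl | exact absurd rfl h

/-- The stacks of the reduction itself. -/
def own (s : Mem) : ∀ w, List (Alph w)
  | .inl c => List.replicate (s.count c) ()
  | .inr .port => []
  | .inr t => s.word t

theorem update_own_inl (s : Mem) (c : Counter) (n : ℕ) :
    update s.own (.inl c) (List.replicate n ()) = (s.setCount n c).own := by
  refine update_eq_iff.2 ⟨by simp [own], ?_⟩
  rintro (c' | t) h
  · rw [own, own, count_setCount_of_ne]
    rintro rfl
    exact h rfl
  · cases c <;> cases t <;> rfl

theorem update_own_inr (s : Mem) (t : Tape) (l : List t.Alph) (ht : t ≠ .port) :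
    update s.own (.inr t) l = (s.setWord t l).own := by
  refine update_eq_iff.2 ⟨?_, ?_⟩
  · cases t <;> first | rfl | exact absurd rfl ht
  · rintro (c' | t') h
    · cases c' <;> cases t <;> rfl
    · cases t <;> cases t' <;> first | rfl | exact absurd rfl h

/-- The word at the port lies on a stack of the called machine; the reduction's own stack with index
`port` is always empty. -/
theorem own_setWord_port (s : Mem) (l : List Letter) : (s.setWord .port l).own = s.own := by
  funext w
  rcases w with c | t
  · cases c <;> rfl
  · cases t <;> rfl

end Mem

/-! ### Programs acting on the memory of the reduction -/

/-- A stack of another machine, with letters of the standard alphabet. -/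
structure Port {K : Type} (B : K → Type) where
  k : K
  dec : B k ≃ Letter

variable {K : Type} {B : K → Type} {τ : Type} (P : Port B)

namespace Port

/-- The stack belonging to a tape. -/
abbrev loc : Tape → (Counter ⊕ Tape) ⊕ K
  | .port => .inr P.k
  | t => .inl (.inr t)

/-- The letters on the stack belonging to a tape. -/
def dec' : (t : Tape) → SumAlph Alph B (P.loc t) ≃ t.Alph
  | .port => P.dec
  | .inp => Equiv.refl _
  | .out => Equiv.refl _
  | .colors => Equiv.refl _
  | .result => Equiv.refl _
  | .matrix => Equiv.refl _
  | .diag => Equiv.refl _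

instance (t : Tape) : Fintype (SumAlph Alph B (P.loc t)) := Fintype.ofEquiv _ (P.dec' t).symm

end Port

/-- Programs for the reduction. -/
abbrev Prog (B : K → Type) (τ : Type) := Code (SumAlph Alph B) τ

namespace Prog

/-- Increment a counter. -/
def inc (c : Counter) : Prog B τ := Code.push (.inl (.inl c)) ()

/-- Decrement a counter and continue depending on whether it was positive. -/
def dec (c : Counter) (p q : Prog B τ) : Prog B τ :=
  haveI : Fintype (SumAlph Alph B (.inl (.inl c))) := inferInstanceAs (Fintype Unit)
  Code.popCase (.inl (.inl c)) p fun _ => q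

/-- Decrement a counter to zero, and run a program after each decrement. -/
def drain (c : Counter) (p : Prog B τ) : Prog B τ :=
  haveI : Fintype (SumAlph Alph B (.inl (.inl c))) := inferInstanceAs (Fintype Unit)
  Code.loop (.inl (.inl c)) (fun _ => false) fun _ => p

/-- Write a letter. -/
def put (t : Tape) (a : t.Alph) : Prog B τ := Code.push (P.loc t) ((P.dec' t).symm a)

/-- Read a letter and continue depending on it. -/
def get (t : Tape) (p : Prog B τ) (q : t.Alph → Prog B τ) : Prog B τ :=
  Code.popCase (P.loc t) p fun a => q (P.dec' t a)

/-- Read letters up to a letter satisfying `final` and run a program for each of them. -/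
def each (t : Tape) (final : t.Alph → Bool) (body : t.Alph → Prog B τ) : Prog B τ :=
  Code.loop (P.loc t) (fun a => final (P.dec' t a)) fun a => body (P.dec' t a)

end Prog

variable [DecidableEq K]

/-- All stacks, those of the called machine being empty, with the possible exception of the port. -/
def Mem.stk (s : Mem) : ∀ k, List (SumAlph Alph B k) :=
  merge s.own (single P.k (s.port.map P.dec.symm))

theorem Mem.update_stk_inl (s : Mem) (c : Counter) (n : ℕ) :
    update (s.stk P) (.inl (.inl c)) (List.replicate n ()) = (s.setCount n c).stk P := by
  refine (update_merge_inl ..).trans ?_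
  rw [Mem.update_own_inl]
  cases c <;> rfl

theorem Mem.update_stk_loc (s : Mem) (t : Tape) (l : List t.Alph) :
    update (s.stk P) (P.loc t) (l.map (P.dec' t).symm) = (s.setWord t l).stk P := by
  by_cases ht : t = .port
  · subst ht
    refine (update_merge_inr ..).trans ?_
    rw [single, update_idem, Mem.stk, Mem.own_setWord_port]
    rfl
  · have := congrArg (fun S => merge S (single P.k (s.port.map P.dec.symm)))
      (s.update_own_inr t l ht)
    cases t <;> first
      | exact absurd rfl ht
      | exact Eq.trans (by rw [← update_merge_inl]; exact congrArg _ (List.map_id _)) this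

theorem Mem.stk_loc (s : Mem) (t : Tape) :
    s.stk P (P.loc t) = (s.word t).map (P.dec' t).symm := by
  cases t <;> first
    | exact (List.map_id _).symm
    | exact update_self P.k (s.port.map P.dec.symm) fun _ => []

/-- The program `p` turns the memory `s` into `s'` within `T` steps. -/
def Exec (p : Prog B τ) (s s' : Mem) (T : ℕ) : Prop := Run p (s.stk P) (s'.stk P) T

namespace Exec

variable {P} {p q : Prog B τ} {s s' s'' : Mem} {T T' n : ℕ} {c : Counter} {t : Tape}

theorem cast (h : Exec P p s s' T) (hs : s' = s'') (hT : T ≤ T') : Exec P p s s'' T' :=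
  hs ▸ Run.mono h hT

theorem mono (h : Exec P p s s' T) (hT : T ≤ T') : Exec P p s s' T' := h.cast rfl hT

theorem skip (s : Mem) : Exec P (Code.skip : Prog B τ) s s 1 := Run.skip _

theorem seq (h : Exec P p s s' T) (h' : Exec P q s' s'' T') :
    Exec P (Code.seq p q) s s'' (T + T') := Run.seq h h'

theorem inc (s : Mem) (c : Counter) :
    Exec P (Prog.inc c : Prog B τ) s (s.setCount (s.count c + 1) c) 1 := by
  have := Run.push (τ := τ) (s.stk P) (.inl (.inl c)) ()
  rwa [show () :: s.stk P (.inl (.inl c)) = List.replicate (s.count c + 1) () from rfl,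
    Mem.update_stk_inl] at this

theorem dec_zero (hc : s.count c = 0) (h : Exec P p s s' T) :
    Exec P (Prog.dec c p q) s s' (T + 1) := by
  refine Run.popCase_nil ?_ h
  show List.replicate (s.count c) () = _
  rw [hc]; rfl

theorem stk_inl (hc : s.count c = n + 1) :
    s.stk P (.inl (.inl c)) = () :: List.replicate n () := by
  show List.replicate (s.count c) () = _
  rw [hc]; rfl

theorem dec_succ (hc : s.count c = n + 1) (h : Exec P q (s.setCount n c) s' T) :
    Exec P (Prog.dec c p q) s s' (T + 1) := by
  refine Run.popCase_cons (stk_inl hc) ?_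
  rw [Mem.update_stk_inl]
  exact h

theorem drain_zero (hc : s.count c = 0) : Exec P (Prog.drain c p) s s 1 := by
  refine Run.loop_nil ?_
  show List.replicate (s.count c) () = _
  rw [hc]; rfl

theorem drain_succ (hc : s.count c = n + 1) (h : Exec P p (s.setCount n c) s' T)
    (h' : Exec P (Prog.drain c p) s' s'' T') :
    Exec P (Prog.drain c p) s s'' (T + T' + 1) := by
  refine Run.loop_cons (stk_inl hc) rfl ?_ h'
  rw [Mem.update_stk_inl]
  exact h

theorem put (s : Mem) (t : Tape) (a : t.Alph) :
    Exec P (Prog.put P t a : Prog B τ) s (s.setWord t (a :: s.word t)) 1 := by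
  have := Run.push (τ := τ) (s.stk P) (P.loc t) ((P.dec' t).symm a)
  rwa [Mem.stk_loc, ← List.map_cons, Mem.update_stk_loc] at this

variable {r : t.Alph → Prog B τ} {final : t.Alph → Bool} {a : t.Alph} {l : List t.Alph}

theorem get_nil (ht : s.word t = []) (h : Exec P p s s' T) :
    Exec P (Prog.get P t p r) s s' (T + 1) :=
  Run.popCase_nil (by rw [Mem.stk_loc, ht]; rfl) h

theorem get_cons (ht : s.word t = a :: l) (h : Exec P (r a) (s.setWord t l) s' T) :
    Exec P (Prog.get P t p r) s s' (T + 1) := by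
  refine Run.popCase_cons (by rw [Mem.stk_loc, ht]; rfl) ?_
  rw [Mem.update_stk_loc, Equiv.apply_symm_apply]
  exact h

theorem each_nil (ht : s.word t = []) : Exec P (Prog.each P t final r) s s 1 :=
  Run.loop_nil (by rw [Mem.stk_loc, ht]; rfl)

theorem each_stop (ht : s.word t = a :: l) (ha : final a = true) :
    Exec P (Prog.each P t final r) s (s.setWord t l) 1 := by
  have := Run.loop_stop (S := s.stk P) (k := P.loc t) (a := (P.dec' t).symm a)
    (final := fun a => final (P.dec' t a)) (body := fun a => r (P.dec' t a))
    (by rw [Mem.stk_loc, ht]; rfl) (by simpa using ha)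
  rwa [Mem.update_stk_loc] at this

theorem each_cons (ht : s.word t = a :: l) (ha : final a = false)
    (h : Exec P (r a) (s.setWord t l) s' T) (h' : Exec P (Prog.each P t final r) s' s'' T') :
    Exec P (Prog.each P t final r) s s'' (T + T' + 1) := by
  refine Run.loop_cons (a := (P.dec' t).symm a) (by rw [Mem.stk_loc, ht]; rfl)
    (by simpa using ha) ?_ h'
  rw [Mem.update_stk_loc, Equiv.apply_symm_apply]
  exact h

end Exec

end StackProgram

namespace StackProgram

variable {K : Type} {B : K → Type} {τ : Type} (P : Port B)

/-! ### Writing the matching instance -/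

namespace Prog

/-- Count `c` down while counting `c'` up, run `p` in each round, and finally restore `c`. -/
def preserve (c c' : Counter) (p : Prog B τ) : Prog B τ :=
  .seq (drain c (.seq (inc c') p)) (drain c' (inc c))

/-- Read the required number of blue edges. -/
def readExcess : Prog B τ :=
  .seq (each P .inp (fun a => decide (a = .comma)) fun _ => inc .excess)
    (get P .inp .skip fun _ => .skip)

/-- Note an entry of the matrix. -/
def noteEntry (b : Bool) : Prog B τ :=
  .seq (put P .colors .comma) (.seq (put P .matrix (some b)) (inc .low))

/-- Read the matrix. -/
def readMatrix : Prog B τ :=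
  each P .inp (fun _ => false) fun
    | .comma => noteEntry P false
    | .semicolon => .seq (put P .matrix none) (.seq (inc .outer) (inc .inner))
    | .stroke => get P .inp .skip fun
      | .comma => noteEntry P true
      | .stroke => get P .inp .skip fun _ => .seq (put P .colors .stroke) (noteEntry P true)
      | .semicolon => .skip

/-- Write the number one. -/
def putOne : Prog B τ := .seq (put P .port .comma) (put P .port .stroke)

/-- Write the distance between samples that do not belong together. -/
def putOff : Prog B τ := .seq (putOne P) (put P .diag (some none))

/-- Write the distance between samples that belong together. -/
def putDiag (a : Option Bool) : Prog B τ :=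
  .seq (dec .low .skip .skip) (.seq (inc .high)
    (.seq (if a = some true then put P .port .comma else putOne P) (put P .diag (some a))))

/-- Write the distances from one treatment sample. -/
def distRow : Prog B τ :=
  .seq (put P .port .semicolon) (.seq (put P .diag none) (.seq (preserve .high .temp (putOff P))
    (.seq (each P .matrix (fun a => a.isNone) (putDiag P)) (preserve .low .temp (putOff P)))))

/-- Write all distances. -/
def dists : Prog B τ :=
  .seq (get P .matrix .skip fun _ => .skip) (preserve .outer .outer' (distRow P))

/-- Write the colours of all entries of the matrix. -/
def colorRow : Prog B τ :=
  .seq (put P .port .semicolon) (each P .colors (fun _ => false) fun a => put P .port a)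

/-- Write the numbers below the value of the counter `inner`. -/
def range : Prog B τ :=
  preserve .inner .inner'
    (.seq (put P .port .comma) (preserve .inner .temp (put P .port .stroke)))

/-- Write the columns of all entries of the matrix. -/
def columnRow : Prog B τ := .seq (put P .port .semicolon) (preserve .outer .outer' (range P))

/-- Write as many ones as required, preceded by zeros. -/
def demandRow : Prog B τ :=
  .seq (put P .port .semicolon)
    (preserve .outer .outer' (dec .excess (put P .port .comma) (putOne P)))

/-- Write the first levels of the treatment samples. -/
def rangeRow : Prog B τ := .seq (put P .port .semicolon) (range P)

/-- Write the value of the counter `outer`. -/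
def sizeRow : Prog B τ :=
  .seq (put P .port .semicolon)
    (.seq (put P .port .comma) (preserve .outer .outer' (put P .port .stroke)))

/-- The translation of an exact matching instance. -/
def encodeInstance : Prog B τ :=
  .seq (readExcess P) (.seq (put P .matrix none) (.seq (readMatrix P) (.seq (dists P)
    (.seq (colorRow P) (.seq (columnRow P) (.seq (demandRow P) (.seq (rangeRow P) (sizeRow P))))))))

end Prog

open Prog ExactMatchingInstance

/-- The second level of a control sample. -/
def colorCode (e : Option EdgeColor) : ℕ := if e = some .blue then 1 else 0

/-- The contents of the tape `matrix`, given the rows in reverse order. -/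
def matrixWord (rows : List (List (Option EdgeColor))) : List (Option Bool) :=
  rows.flatMap fun row => (row.map fun e => some e.isSome).reverse ++ [none]

/-- The distance between samples that belong together. -/
def edgeCost (e : Option EdgeColor) : ℕ := if e.isSome then 0 else 1

variable [DecidableEq K]

namespace Exec

variable {P} {p : Prog B τ}

theorem drain_inc (s : Mem) {c c' : Counter} (h : c ≠ c') (n m : ℕ) :
    Exec P (drain c' (Prog.inc c) : Prog B τ) ((s.setCount m c).setCount n c')
      ((s.setCount (m + n) c).setCount 0 c') (2 * n + 1) := by
  induction n generalizing m with
  | zero => exact drain_zero (by simp)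
  | succ n ih =>
    refine (drain_succ (n := n) (by simp) (inc _ c) ?_).mono
      (show 1 + (2 * n + 1) + 1 ≤ _ by omega)
    have := ih (m + 1)
    rw [Mem.setCount_setCount, Mem.count_setCount_of_ne _ _ h.symm, Mem.count_setCount,
      ← Mem.setCount_comm _ _ _ h, Mem.setCount_setCount]
    rwa [show m + (n + 1) = m + 1 + n by omega]

/-- The index of `F` is the number of rounds still to come, so `F n` is the start and `F 0` the end.
The body sees the counters at `j` and `n - j` and must leave both alone. A round costs `T + 2`,
restoring costs 2 per unit, and the two loops end with one step each. -/
theorem preserve {c c' : Counter} (h : c ≠ c') (F : ℕ → Mem) (n T : ℕ)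
    (hp : ∀ j < n, Exec P p (((F (j + 1)).setCount j c).setCount (n - j) c')
      (((F j).setCount j c).setCount (n - j) c') T) :
    Exec P (Prog.preserve c c' p) (((F n).setCount n c).setCount 0 c')
      (((F 0).setCount n c).setCount 0 c') (n * (T + 4) + 2) := by
  have key : ∀ j ≤ n, Exec P (drain c (.seq (Prog.inc c') p))
      (((F j).setCount j c).setCount (n - j) c') (((F 0).setCount 0 c).setCount n c')
      (j * (T + 2) + 1) := by
    intro j
    induction j with
    | zero =>
      intro _
      refine (drain_zero ?_).cast (by simp) (by omega)
      rw [Mem.count_setCount_of_ne _ _ h.symm, Mem.count_setCount]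
    | succ j ih =>
      intro hj
      refine (drain_succ (n := j) ?_ (seq (inc _ c') ?_) (ih (by omega))).mono
        (show 1 + T + (j * (T + 2) + 1) + 1 ≤ _ by rw [Nat.succ_mul]; omega)
      · rw [Mem.count_setCount_of_ne _ _ h.symm, Mem.count_setCount]
      · have := hp j (by omega)
        rw [Mem.count_setCount_of_ne _ _ h, Mem.count_setCount, Mem.setCount_comm _ _ _ h.symm,
          Mem.setCount_setCount, Mem.setCount_setCount]
        rwa [show n - (j + 1) + 1 = n - j by omega]
  have hn := key n le_rfl
  rw [Nat.sub_self] at hn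
  refine (seq hn (drain_inc (F 0) h n 0)).cast ?_ ?_
  · simp
  · rw [Nat.mul_add, Nat.mul_add]; omega

theorem readExcess (s : Mem) (k : ℕ) (l : List Letter) :
    Exec P (Prog.readExcess P : Prog B τ) { s with inp := encodeNat k ++ .semicolon :: l }
      { s with inp := l, excess := k + s.excess } (2 * k + 3) := by
  have key : ∀ s : Mem, Exec P
      (Prog.each P .inp (fun a => decide (a = .comma)) fun _ => Prog.inc .excess : Prog B τ)
      { s with inp := encodeNat k ++ .semicolon :: l }
      { s with inp := .semicolon :: l, excess := k + s.excess } (2 * k + 1) := by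
    induction k with
    | zero => exact fun s => (each_stop rfl rfl).cast (by simp [Mem.setWord]) le_rfl
    | succ k ih =>
      intro s
      refine (each_cons (t := .inp) (a := Letter.stroke) (l := encodeNat k ++ .semicolon :: l) rfl rfl
        (inc _ _) (ih { s with excess := s.excess + 1 })).cast ?_
        (show 1 + (2 * k + 1) + 1 ≤ _ by omega)
      simp; omega
  exact (seq (key s) (get_cons rfl (skip _))).mono (by omega)

theorem noteEntry (s : Mem) (b : Bool) :
    Exec P (Prog.noteEntry P b : Prog B τ) s { s with
      colors := .comma :: s.colors, matrix := some b :: s.matrix, low := s.low + 1 } 3 :=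
  seq (put _ _ _) (seq (put _ _ _) (inc _ _))

/-- The loop reads letters rather than numbers, so an entry cannot be specified on its own. Instead,
a run on the remaining input is extended backwards by the entry. -/
theorem readMatrix_entry {s s' : Mem} {T : ℕ} (e : Option EdgeColor) (l : List Letter)
    (h : Exec P (Prog.readMatrix P : Prog B τ) { s with
      inp := l
      colors := (encodeNat (colorCode e)).reverse ++ s.colors
      matrix := some e.isSome :: s.matrix
      low := s.low + 1 } s' T) :
    Exec P (Prog.readMatrix P : Prog B τ) { s with inp := encodeNat (entry e) ++ l } s' (T + 7) := by
  match e, h with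
  | none, h =>
    exact (each_cons (t := .inp) (a := Letter.comma) (l := l) rfl rfl (noteEntry _ _) h).mono (by omega)
  | some .red, h =>
    exact (each_cons (t := .inp) (a := Letter.stroke) (l := Letter.comma :: l) rfl rfl
      (get_cons (t := .inp) (a := Letter.comma) (l := l) rfl (noteEntry _ _)) h).mono (by omega)
  | some .blue, h =>
    exact (each_cons (t := .inp) (a := Letter.stroke) (l := Letter.stroke :: Letter.comma :: l) rfl rfl
      (get_cons (t := .inp) (a := Letter.stroke) (l := Letter.comma :: l) rfl
        (get_cons (t := .inp) (a := Letter.comma) (l := l) rfl (seq (put _ _ _) (noteEntry _ _)))) h).mono (by omega)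

theorem readMatrix_row {s s' : Mem} {T : ℕ} (row : List (Option EdgeColor)) (l : List Letter)
    (h : Exec P (Prog.readMatrix P : Prog B τ) { s with
      inp := l
      colors := (row.flatMap fun e => encodeNat (colorCode e)).reverse ++ s.colors
      matrix := (row.map fun e => some e.isSome).reverse ++ s.matrix
      low := row.length + s.low } s' T) :
    Exec P (Prog.readMatrix P : Prog B τ)
      { s with inp := (row.flatMap fun e => encodeNat (entry e)) ++ l } s'
      (7 * row.length + T) := by
  induction row generalizing s with
  | nil => simpa using h
  | cons e row ih =>
    rw [List.flatMap_cons, List.append_assoc]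
    refine (readMatrix_entry e _ (ih (s := { s with
      colors := (encodeNat (colorCode e)).reverse ++ s.colors
      matrix := some e.isSome :: s.matrix
      low := s.low + 1 }) ?_)).mono ?_
    · convert h using 2 <;> simp
      omega
    · simp only [List.length_cons]; omega

/-- Pushing reverses everything, so the last row ends on top. The invariant keeps a `none` above the
stored rows; it becomes the end mark of the next row, which is why one `none` is written before
reading starts. -/
theorem readMatrix (s : Mem) (rows L : List (List (Option EdgeColor))) :
    Exec P (Prog.readMatrix P : Prog B τ)
      { s with inp := encodeTable (rows.map (List.map entry)), matrix := none :: matrixWord L }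
      { s with
        inp := []
        colors := (rows.flatten.flatMap fun e => encodeNat (colorCode e)).reverse ++ s.colors
        matrix := none :: matrixWord (rows.reverse ++ L)
        low := rows.flatten.length + s.low
        outer := rows.length + s.outer
        inner := rows.length + s.inner }
      (7 * rows.flatten.length + 4 * rows.length + 1) := by
  induction rows generalizing s L with
  | nil => exact (each_nil rfl).cast (by simp [encodeTable]) (by simp)
  | cons row rows ih =>
    have h : encodeTable ((row :: rows).map (List.map entry)) =
        (row.flatMap fun e => encodeNat (entry e)) ++
          (.semicolon :: encodeTable (rows.map (List.map entry))) := by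
      simp [encodeTable, encodeRow, List.flatMap_map]
    rw [h]
    refine (readMatrix_row (s := { s with matrix := none :: matrixWord L }) row _
      (each_cons (T' := 7 * rows.flatten.length + 4 * rows.length + 1)
      (t := .inp) (a := Letter.semicolon) (l := encodeTable (rows.map (List.map entry))) rfl rfl
        (seq (put _ _ _) (seq (inc _ _) (inc _ _))) ?_)).mono ?_
    · have hrow := ih { s with
        colors := (row.flatMap fun e => encodeNat (colorCode e)).reverse ++ s.colors
        low := row.length + s.low
        outer := s.outer + 1
        inner := s.inner + 1 } (row :: L)
      rw [show matrixWord (row :: L) =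
        (row.map fun e => some e.isSome).reverse ++ none :: matrixWord L by simp [matrixWord]] at hrow
      refine hrow.cast ?_ le_rfl
      simp
      omega
    · simp; omega

theorem putOne (s : Mem) :
    Exec P (Prog.putOne P : Prog B τ) s { s with port := encodeNat 1 ++ s.port } 2 :=
  seq (put _ _ _) (put _ _ _)

theorem putOff (s : Mem) :
    Exec P (Prog.putOff P : Prog B τ) s
      { s with port := encodeNat 1 ++ s.port, diag := some none :: s.diag } 3 :=
  seq (putOne _) (put _ _ _)

end Exec

end StackProgram

/-! ### Writing the distance matrix -/

namespace StackProgram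

variable {K : Type} {B : K → Type} {τ : Type}

open Prog ExactMatchingInstance

/-- A row of the tape `diag`. -/
def diagRow (l : ℕ) (row : List (Option EdgeColor)) (h : ℕ) : List (Option (Option Bool)) :=
  List.replicate l (some none) ++ row.map (fun e => some (some e.isSome)) ++
    List.replicate h (some none) ++ [none]

/-- A row of the distance matrix. -/
def distList (l : ℕ) (row : List (Option EdgeColor)) (h : ℕ) : List ℕ :=
  List.replicate l 1 ++ row.map edgeCost ++ List.replicate h 1

/-- The distance matrix for a quadratic matrix of entries. -/
def distTable (rows : List (List (Option EdgeColor))) : List (List ℕ) :=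
  rows.mapIdx fun t row => distList (t * rows.length) row ((rows.length - (t + 1)) * rows.length)

/-- The contents of the tape `diag` for a quadratic matrix of entries. -/
def diagTable (rows : List (List (Option EdgeColor))) : List (List (Option (Option Bool))) :=
  rows.mapIdx fun t row => diagRow (t * rows.length) row ((rows.length - (t + 1)) * rows.length)

variable [DecidableEq K]

namespace Exec

variable {P : Port B} {p : Prog B τ}

theorem conv {s₀ s s' s₀' : Mem} {T T' : ℕ} (h : Exec P p s s' T) (hs : s₀ = s) (hs' : s' = s₀')
    (hT : T ≤ T') : Exec P p s₀ s₀' T' := by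
  subst hs
  exact h.cast hs' hT

theorem preserve_putOff (s : Mem) (n : ℕ) {c : Counter} (hc : c ≠ .temp) :
    Exec P (Prog.preserve c .temp (Prog.putOff P) : Prog B τ) ((s.setCount n c).setCount 0 .temp)
      ((({ s with
        port := (List.replicate n 1).flatMap encodeNat ++ s.port
        diag := List.replicate n (some none) ++ s.diag } : Mem).setCount n c).setCount 0 .temp)
      (n * 7 + 2) := by
  refine (preserve (p := Prog.putOff P) hc (fun j => { s with
    port := (List.replicate (n - j) 1).flatMap encodeNat ++ s.port
    diag := List.replicate (n - j) (some none) ++ s.diag }) n 3 fun j hj => ?_).conv ?_ ?_ le_rfl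
  · refine (putOff _).conv rfl ?_ le_rfl
    obtain ⟨m, hm⟩ : ∃ m, n - j = m + 1 := ⟨n - (j + 1), by omega⟩
    rw [hm, show n - (j + 1) = m by omega, List.replicate_succ, List.replicate_succ]
    cases c <;> simp [Mem.setCount]
  · simp
  · simp

theorem putDiag (s : Mem) (l : ℕ) (a : Option Bool) :
    Exec P (Prog.putDiag P a : Prog B τ) { s with low := l + 1 }
      { s with
        low := l
        high := s.high + 1
        port := encodeNat (if a = some true then 0 else 1) ++ s.port
        diag := some a :: s.diag } 6 := by
  refine (seq (dec_succ (n := l) rfl (skip _)) (seq (inc _ _)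
    (seq (T := 2) (s' := { s with
      low := l
      high := s.high + 1
      port := encodeNat (if a = some true then 0 else 1) ++ s.port }) ?_ (put _ _ _)))).mono
    (by omega)
  split_ifs
  · exact (put _ _ _).mono (by omega)
  · exact putOne _

/-- Each entry passes one unit from `low` to `high`. Thus, between rows, `low` and `high` are the
numbers of matrix entries not yet written and already written as diagonal entries. -/
theorem each_putDiag (s : Mem) (l : ℕ) (row : List (Option EdgeColor)) (w : List (Option Bool)) :
    Exec P (Prog.each P .matrix (fun a => a.isNone) (Prog.putDiag P) : Prog B τ)
      { s with
        low := row.length + l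
        matrix := (row.map fun e => some e.isSome) ++ none :: w }
      { s with
        low := l
        high := s.high + row.length
        matrix := w
        port := row.reverse.flatMap (fun e => encodeNat (edgeCost e)) ++ s.port
        diag := row.reverse.map (fun e => some (some e.isSome)) ++ s.diag }
      (row.length * 7 + 1) := by
  induction row generalizing s with
  | nil =>
    exact (each_stop (t := .matrix) (final := fun a => a.isNone) (a := none) (l := w) rfl rfl).cast
      (by simp [Mem.setWord]) (by omega)
  | cons e row ih =>
    refine (each_cons (t := .matrix) (a := some e.isSome)
      (l := (row.map fun e => some e.isSome) ++ none :: w) rfl rfl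
      ((putDiag { s with matrix := (row.map fun e => some e.isSome) ++ none :: w }
        (row.length + l) (some e.isSome)).conv ?_ rfl le_rfl)
      (ih { s with
        high := s.high + 1
        port := encodeNat (edgeCost e) ++ s.port
        diag := some (some e.isSome) :: s.diag } |>.conv ?_ rfl le_rfl)).cast ?_ ?_
    · simp [Mem.setWord]; omega
    · simp [edgeCost]
    · simp; omega
    · simp only [List.length_cons]; omega

/-- The port is a stack, so a row is written from its end: the ones behind the diagonal block, the
block, the ones before it. The tape `diag` receives one letter per distance, for decoding the answer
later. -/
theorem distRow (s : Mem) (l h : ℕ) (row : List (Option EdgeColor)) (w : List (Option Bool)) :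
    Exec P (Prog.distRow P : Prog B τ)
      { s with
        low := row.length + l
        high := h
        temp := 0
        matrix := (row.map fun e => some e.isSome).reverse ++ none :: w }
      { s with
        low := l
        high := h + row.length
        temp := 0
        matrix := w
        port := encodeRow (distList l row h) ++ s.port
        diag := diagRow l row h ++ s.diag }
      ((l + h + row.length) * 7 + 7) := by
  refine (seq (put _ _ _) (seq (put _ _ _) (seq
    ((preserve_putOff { s with
        low := row.length + l
        matrix := (row.map fun e => some e.isSome).reverse ++ none :: w
        port := .semicolon :: s.port
        diag := none :: s.diag } h (c := .high) (by simp)).conv rfl rfl le_rfl)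
    (seq
      ((each_putDiag { s with
          high := h
          temp := 0
          port := (List.replicate h 1).flatMap encodeNat ++ .semicolon :: s.port
          diag := List.replicate h (some none) ++ none :: s.diag } l row.reverse w).conv ?_ rfl le_rfl)
      ((preserve_putOff { s with
          high := h + row.length
          matrix := w
          port := row.flatMap (fun e => encodeNat (edgeCost e)) ++
            ((List.replicate h 1).flatMap encodeNat ++ .semicolon :: s.port)
          diag := row.map (fun e => some (some e.isSome)) ++
            (List.replicate h (some none) ++ none :: s.diag) } l (c := .low) (by simp)).conv
        ?_ rfl le_rfl))))).cast ?_ ?_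
  · simp [Mem.setCount]
  · simp [Mem.setCount]
  · simp [Mem.setCount, encodeRow, distList, diagRow, List.flatMap_map]
  · simp; omega

theorem dists (s : Mem) (rows : List (List (Option EdgeColor)))
    (hrows : ∀ row ∈ rows, row.length = rows.length) :
    Exec P (Prog.dists P : Prog B τ)
      { s with
        outer := rows.length
        outer' := 0
        low := rows.length * rows.length
        high := 0
        temp := 0
        matrix := none :: matrixWord rows.reverse }
      { s with
        outer := rows.length
        outer' := 0
        low := 0
        high := rows.length * rows.length
        temp := 0
        matrix := []
        port := encodeTable (distTable rows) ++ s.port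
        diag := (diagTable rows).flatten ++ s.diag }
      (rows.length * (rows.length * rows.length * 7 + 11) + 4) := by
  set q := rows.length with hq
  refine (seq (get_cons (t := .matrix) (a := none) (l := matrixWord rows.reverse) rfl (skip _))
    ((preserve (p := Prog.distRow P) (c := .outer) (c' := .outer') (by simp)
      -- With `j` rows left, `low = j * q` and `high = (q - j) * q`. These are the padding lengths
      -- required once the next row has been moved from `low` to `high`.
      (fun j => { s with
        matrix := matrixWord (rows.take j).reverse
        low := j * q
        high := (q - j) * q
        temp := 0
        port := encodeTable ((distTable rows).drop j) ++ s.port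
        diag := ((diagTable rows).drop j).flatten ++ s.diag }) q (q * q * 7 + 7)
      fun j hj => ?_).conv ?_ rfl le_rfl)).cast ?_ ?_
  · have hj' : rows[j].length = q := hrows _ (List.getElem_mem _)
    refine (distRow { s with
      outer := j
      outer' := q - j
      port := encodeTable ((distTable rows).drop (j + 1)) ++ s.port
      diag := ((diagTable rows).drop (j + 1)).flatten ++ s.diag } (j * q) ((q - (j + 1)) * q) rows[j]
      (matrixWord (rows.take j).reverse)).conv ?_ ?_ ?_
    · have : (rows.take (j + 1)).reverse = rows[j] :: (rows.take j).reverse := by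
        rw [List.take_succ_eq_append_getElem hj, List.reverse_append]; rfl
      rw [this]
      simp [Mem.setCount, matrixWord, hj', Nat.succ_mul, Nat.add_comm]
    · have h₁ : j < (distTable rows).length := by simpa [distTable] using hj
      have h₂ : j < (diagTable rows).length := by simpa [diagTable] using hj
      rw [List.drop_eq_getElem_cons h₁, List.drop_eq_getElem_cons h₂, hj', ← Nat.succ_mul,
        show (q - (j + 1)).succ = q - j by omega]
      simp [Mem.setCount, encodeTable, distTable, diagTable, ← hq]
    -- Every row has `q * q` distances, so all rounds share one time bound.
    · have : j * q + (q - (j + 1)) * q + q = q * q := by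
        rw [← Nat.add_mul, ← Nat.succ_mul]; congr 1; omega
      rw [hj', this]
  · have h₁ : (distTable rows).drop q = [] := by simp [distTable, hq]
    have h₂ : (diagTable rows).drop q = [] := by simp [diagTable, hq]
    rw [h₁, h₂]
    simp [Mem.setCount, Mem.setWord, hq, encodeTable]
  · simp [Mem.setCount, matrixWord]
  · rw [Nat.mul_add, Nat.mul_add]; omega

end Exec

end StackProgram

/-! ### Writing the levels and the whole instance -/

namespace StackProgram

variable {K : Type} {B : K → Type} {τ : Type}

open Prog ExactMatchingInstance

/-- The last `k` of `q` samples have level one, the others have level zero. -/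
def demandList (k q : ℕ) : List ℕ := (List.range q).map fun t => if q ≤ t + k then 1 else 0

/-- The translation of an exact matching instance. -/
def instanceTable (k : ℕ) (rows : List (List (Option EdgeColor))) : List (List ℕ) :=
  [[rows.length], List.range rows.length, demandList k rows.length,
    (List.replicate rows.length (List.range rows.length)).flatten,
    rows.flatten.map colorCode] ++ distTable rows

variable [DecidableEq K]

namespace Exec

variable {P : Port B} {p : Prog B τ}

theorem colorRow (s : Mem) (w : List Letter) :
    Exec P (Prog.colorRow P : Prog B τ) { s with colors := w }
      { s with colors := [], port := w.reverse ++ .semicolon :: s.port } (2 * w.length + 2) := by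
  have key : ∀ s : Mem, Exec P
      (Prog.each P .colors (fun _ => false) fun a => Prog.put P .port a : Prog B τ)
      { s with colors := w } { s with colors := [], port := w.reverse ++ s.port }
      (2 * w.length + 1) := by
    induction w with
    | nil => exact fun s => each_nil rfl
    | cons a w ih =>
      intro s
      exact (each_cons (t := .colors) (a := a) (l := w) rfl rfl (put _ _ _)
        (ih { s with port := a :: s.port })).cast (by simp) (by simp only [List.length_cons]; omega)
  exact (seq (put _ _ _) (key { s with port := .semicolon :: s.port })).mono (by omega)

theorem put_strokes (s : Mem) (n : ℕ) :
    Exec P (.seq (Prog.put P .port .comma)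
      (Prog.preserve .inner .temp (Prog.put P .port .stroke)) : Prog B τ)
      { s with inner := n, temp := 0 }
      { s with inner := n, temp := 0, port := encodeNat n ++ s.port } (n * 5 + 3) := by
  refine (seq (put _ _ _) ((preserve (p := Prog.put P .port .stroke) (c := .inner) (c' := .temp)
    (by simp) (fun j => { s with
      port := List.replicate (n - j) .stroke ++ .comma :: s.port }) n 1 fun j hj => ?_).conv
    ?_ rfl le_rfl)).cast ?_ (by omega)
  · refine (put _ _ _).conv rfl ?_ le_rfl
    rw [show n - j = n - (j + 1) + 1 by omega, List.replicate_succ]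
    rfl
  · simp [Mem.setCount, Mem.setWord, Mem.word]
  · simp [Mem.setCount, encodeNat]

/-- The loop counter `inner` is itself the number to be written: it equals `j` in the round for `j`.
Counting down from `q - 1` gives increasing order on a stack. -/
theorem range (s : Mem) (q : ℕ) :
    Exec P (Prog.range P : Prog B τ) { s with inner := q, inner' := 0, temp := 0 }
      { s with
        inner := q
        inner' := 0
        temp := 0
        port := (List.range q).flatMap encodeNat ++ s.port } (q * (q * 5 + 7) + 2) := by
  refine (preserve (c := .inner) (c' := .inner') (by simp) (fun j => { s with
      temp := 0
      port := ((List.range q).drop j).flatMap encodeNat ++ s.port }) q (q * 5 + 3)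
    fun j hj => ?_).conv ?_ ?_ le_rfl
  · refine (put_strokes { s with
      inner' := q - j
      port := ((List.range q).drop (j + 1)).flatMap encodeNat ++ s.port } j).conv rfl ?_ (by omega)
    rw [List.drop_eq_getElem_cons (i := j) (by simpa using hj)]
    simp [Mem.setCount]
  · rw [List.drop_eq_nil_of_le (by simp)]
    simp [Mem.setCount]
  · simp [Mem.setCount]

theorem columnRow (s : Mem) (n q : ℕ) :
    Exec P (Prog.columnRow P : Prog B τ)
      { s with outer := n, outer' := 0, inner := q, inner' := 0, temp := 0 }
      { s with
        outer := n
        outer' := 0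
        inner := q
        inner' := 0
        temp := 0
        port := encodeRow (List.replicate n (List.range q)).flatten ++ s.port }
      (n * (q * (q * 5 + 7) + 6) + 3) := by
  refine (seq (put _ _ _) ((preserve (p := Prog.range P) (c := .outer) (c' := .outer')
    (by simp) (fun j => { s with
      inner := q
      inner' := 0
      temp := 0
      port := (List.replicate (n - j) (List.range q)).flatten.flatMap encodeNat ++
        .semicolon :: s.port }) n (q * (q * 5 + 7) + 2) fun j hj => ?_).conv
    ?_ rfl le_rfl)).cast ?_
    (show 1 + (n * (q * (q * 5 + 7) + 6) + 2) ≤ _ by omega)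
  · refine (range { s with
      outer := j
      outer' := n - j
      port := (List.replicate (n - (j + 1)) (List.range q)).flatten.flatMap encodeNat ++
        .semicolon :: s.port } q).conv rfl ?_ le_rfl
    rw [show n - j = n - (j + 1) + 1 by omega, List.replicate_succ, List.flatten_cons,
      List.flatMap_append, List.append_assoc]
    rfl
  · simp [Mem.setCount, Mem.setWord, Mem.word]
  · simp [Mem.setCount, encodeRow]

/-- Writing starts with the last sample, so the ones come first and use up `excess`. What remains is
`k - q` (truncated); it is kept and later forces the answer `none` when `k > q`. -/
theorem demandRow (s : Mem) (k q : ℕ) :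
    Exec P (Prog.demandRow P : Prog B τ) { s with outer := q, outer' := 0, excess := k }
      { s with
        outer := q
        outer' := 0
        excess := k - q
        port := encodeRow (demandList k q) ++ s.port } (q * 7 + 3) := by
  refine (seq (put _ _ _) ((preserve (c := .outer) (c' := .outer') (by simp) (fun j => { s with
      excess := k - (q - j)
      port := ((demandList k q).drop j).flatMap encodeNat ++ .semicolon :: s.port }) q 3
    fun j hj => ?_).conv ?_ rfl le_rfl)).cast ?_ (by omega)
  · rw [List.drop_eq_getElem_cons (l := demandList k q) (i := j) (by simpa [demandList] using hj)]
    -- This is exactly the condition that the counter, now at `k - (q - (j + 1))`, is positive.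
    by_cases h : q ≤ j + k
    · refine (dec_succ (n := k - (q - j)) ?_ (putOne _)).conv rfl ?_ le_rfl
      · show k - (q - (j + 1)) = _
        omega
      · simp [Mem.setCount, demandList, h]
    · refine (dec_zero ?_ (put _ _ _)).conv rfl ?_ (by omega)
      · show k - (q - (j + 1)) = _
        omega
      · simp [Mem.setCount, Mem.setWord, Mem.word, demandList, h, encodeNat]
        omega
  · rw [List.drop_eq_nil_of_le (by simp [demandList])]
    simp [Mem.setCount, Mem.setWord, Mem.word]
  · simp [Mem.setCount, encodeRow]

theorem rangeRow (s : Mem) (q : ℕ) :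
    Exec P (Prog.rangeRow P : Prog B τ) { s with inner := q, inner' := 0, temp := 0 }
      { s with
        inner := q
        inner' := 0
        temp := 0
        port := encodeRow (List.range q) ++ s.port } (q * (q * 5 + 7) + 3) :=
  (seq (put _ _ _) (range { s with port := .semicolon :: s.port } q)).cast
    (by simp [encodeRow]) (by omega)

theorem sizeRow (s : Mem) (q : ℕ) :
    Exec P (Prog.sizeRow P : Prog B τ) { s with outer := q, outer' := 0 }
      { s with outer := q, outer' := 0, port := encodeRow [q] ++ s.port } (q * 5 + 4) := by
  refine (seq (put _ _ _) (seq (put _ _ _) ((preserve (p := Prog.put P .port .stroke) (c := .outer)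
    (c' := .outer') (by simp) (fun j => { s with
      port := List.replicate (q - j) .stroke ++ .comma :: .semicolon :: s.port }) q 1
    fun j hj => ?_).conv ?_ rfl le_rfl))).cast ?_ (by omega)
  · refine (put _ _ _).conv rfl ?_ le_rfl
    rw [show q - j = q - (j + 1) + 1 by omega, List.replicate_succ]
    rfl
  · simp [Mem.setCount, Mem.setWord, Mem.word]
  · simp [Mem.setCount, encodeRow, encodeNat]

theorem length_colors_le (l : List (Option EdgeColor)) :
    (l.flatMap fun e => encodeNat (colorCode e)).length ≤ 2 * l.length := by
  induction l with
  | nil => simp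
  | cons e l ih =>
    have : (encodeNat (colorCode e)).length ≤ 2 := by
      unfold colorCode
      split_ifs <;> simp [encodeNat]
    simp only [List.flatMap_cons, List.length_append, List.length_cons]
    omega

/-- The rows of the table are produced from last to first because the port is a stack. The cubic
bound comes from the `q` rows of `q * q` distances and from the `q * q` column numbers, each below
`q` in unary. -/
theorem encodeInstance (k : ℕ) (rows : List (List (Option EdgeColor)))
    (hrows : ∀ row ∈ rows, row.length = rows.length) (N : ℕ) (hk : k ≤ N) (hN : rows.length ≤ N) :
    Exec P (Prog.encodeInstance P : Prog B τ)
      { inp := encodeTable ([k] :: rows.map (List.map entry)) }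
      { excess := k - rows.length
        outer := rows.length
        inner := rows.length
        high := rows.length * rows.length
        diag := (diagTable rows).flatten
        port := encodeTable (instanceTable k rows) } (100 * (N + 1) ^ 3) := by
  -- The counter `low` holds the number of entries read, which `dists` expects to be a square.
  have hlen : rows.flatten.length = rows.length * rows.length := by
    rw [List.length_flatten, List.map_congr_left hrows]
    simp
  have h₁ := readExcess (P := P) (τ := τ) {} k (encodeTable (rows.map (List.map entry)))
  have h₂ := put (P := P) (τ := τ)
    { inp := encodeTable (rows.map (List.map entry)), excess := k } .matrix none
  have h₃ := readMatrix (P := P) (τ := τ) { excess := k } rows []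
  have h₄ := dists (P := P) (τ := τ) { 
    excess := k
    inner := rows.length
    colors := (rows.flatten.flatMap fun e => encodeNat (colorCode e)).reverse } rows hrows
  have h₅ := colorRow (P := P) (τ := τ) {
    excess := k
    outer := rows.length
    inner := rows.length
    high := rows.length * rows.length
    diag := (diagTable rows).flatten
    port := encodeTable (distTable rows) }
    (rows.flatten.flatMap fun e => encodeNat (colorCode e)).reverse
  have e₅ : (rows.flatten.flatMap fun e => encodeNat (colorCode e)).reverse.reverse ++
      .semicolon :: encodeTable (distTable rows) =
      encodeTable (rows.flatten.map colorCode :: distTable rows) := by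
    rw [List.reverse_reverse]
    simp only [encodeTable, List.flatMap_cons, encodeRow, List.flatMap_map, List.append_assoc,
      List.singleton_append]
  rw [e₅] at h₅
  have h₆ := columnRow (P := P) (τ := τ) {
    excess := k
    high := rows.length * rows.length
    diag := (diagTable rows).flatten
    port := encodeTable (rows.flatten.map colorCode :: distTable rows) } rows.length rows.length
  have h₇ := demandRow (P := P) (τ := τ) {
    inner := rows.length
    high := rows.length * rows.length
    diag := (diagTable rows).flatten
    port := encodeTable ((List.replicate rows.length (List.range rows.length)).flatten ::
      rows.flatten.map colorCode :: distTable rows) } k rows.length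
  have h₈ := rangeRow (P := P) (τ := τ) {
    excess := k - rows.length
    outer := rows.length
    high := rows.length * rows.length
    diag := (diagTable rows).flatten
    port := encodeTable (demandList k rows.length ::
      (List.replicate rows.length (List.range rows.length)).flatten ::
      rows.flatten.map colorCode :: distTable rows) } rows.length
  have h₉ := sizeRow (P := P) (τ := τ) {
    excess := k - rows.length
    inner := rows.length
    high := rows.length * rows.length
    diag := (diagTable rows).flatten
    port := encodeTable (List.range rows.length :: demandList k rows.length ::
      (List.replicate rows.length (List.range rows.length)).flatten ::
      rows.flatten.map colorCode :: distTable rows) } rows.length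
  refine (seq (h₁.conv ?_ rfl le_rfl) (seq (h₂.conv ?_ rfl le_rfl) (seq (h₃.conv ?_ rfl le_rfl)
    (seq (h₄.conv ?_ rfl le_rfl) (seq (h₅.conv ?_ rfl le_rfl) (seq (h₆.conv ?_ rfl le_rfl)
    (seq (h₇.conv ?_ rfl le_rfl) (seq (h₈.conv ?_ rfl le_rfl) (h₉.conv ?_ rfl le_rfl))))))))).cast
    ?_ ?_
  · simp [encodeTable, encodeRow]
  · simp
  · simp [Mem.setWord, Mem.word, matrixWord]
  · simp [hlen]
  · simp [encodeTable]
  · simp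
  · simp [encodeTable]
  · simp [encodeTable]
  · simp [encodeTable]
  · simp [encodeTable, instanceTable]
  · have hc := length_colors_le rows.flatten
    rw [hlen] at hc ⊢
    rw [List.length_reverse]
    generalize (rows.flatten.flatMap fun e => encodeNat (colorCode e)).length = x at hc ⊢
    generalize rows.length = q at hc hN ⊢
    have h2 : q * q ≤ N * N := Nat.mul_le_mul hN hN
    have h3 : q * (q * q) ≤ N * (N * N) := Nat.mul_le_mul hN h2
    nlinarith
end Exec

end StackProgram

namespace StackProgram

variable {K : Type} {B : K → Type} {τ : Type}

/-! ### Reading the answer -/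

namespace Prog

variable (P : Port B)

/-- Make a tape empty. -/
def clear (t : Tape) : Prog B τ := each P t (fun _ => false) fun _ => .skip

/-- Translate the numbers of an answer with the help of the tape `diag`. -/
def readAnswer : Prog B τ :=
  each P .port (fun _ => false) fun
    | .stroke => get P .diag .skip fun o =>
        if o.join.isSome then put P .result .stroke else .skip
    | .comma => .seq
        (get P .diag (inc .excess) fun o =>
          .seq (if o = some (some true) then .skip else inc .excess)
            (each P .diag (fun o => o.isNone) fun _ => .skip))
        (put P .result .comma)
    | .semicolon => put P .result .semicolon

/-- Translate an answer. -/
def decodeAnswer : Prog B τ :=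
  .seq (readAnswer P) (.seq (clear P .diag) (.seq (drain .outer .skip) (.seq (drain .inner .skip)
    (.seq (drain .high .skip) (.seq (drain .excess (clear P .result))
      (each P .result (fun _ => false) fun a => put P .out a))))))

end Prog

/-- What remains of the tape `diag` after the end of the first row. -/
def dropRow (w : List (Option (Option Bool))) : List (Option (Option Bool)) :=
  (w.dropWhile fun o => o.isSome).tail

/-- The tape `diag` after reading the number `a`. -/
def restDiag (a : ℕ) (w : List (Option (Option Bool))) : List (Option (Option Bool)) :=
  dropRow (w.drop (a + 1))

/-- The number of diagonal entries which are passed when reading the number `a`. -/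
def diagValue (a : ℕ) (w : List (Option (Option Bool))) : ℕ :=
  (w.take a).countP fun o => o.join.isSome

/-- Translation of a list of numbers. -/
def decodeList : List ℕ → List (Option (Option Bool)) → List ℕ
  | [], _ => []
  | a :: l, w => diagValue a w :: decodeList l (restDiag a w)

/-- The number of positions in a list which do not point to an edge. -/
def faults : List ℕ → List (Option (Option Bool)) → ℕ
  | [], _ => 0
  | a :: l, w => (if w[a]? = some (some (some true)) then 0 else 1) + faults l (restDiag a w)

/-- Translation of an answer. -/
def translate (k : ℕ) (w : List (Option (Option Bool))) : Option (List ℕ) → Option (List ℕ)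
  | none => none
  | some l => if faults l w + k = 0 then some (decodeList l w) else none

theorem replicate_append_cons {α : Type*} (n : ℕ) (a : α) (l : List α) :
    List.replicate n a ++ a :: l = a :: (List.replicate n a ++ l) := by
  induction n with
  | zero => rfl
  | succ n ih => rw [List.replicate_succ, List.cons_append, ih]; rfl

/-- Keeps the cost of skipping the rest of a row bounded in terms of the original tape. -/
theorem length_restDiag_le (a : ℕ) (w : List (Option (Option Bool))) :
    (restDiag a w).length ≤ w.length := by
  have := (List.dropWhile_suffix (l := w.drop (a + 1)) fun o => o.isSome).length_le
  simp only [restDiag, dropRow, List.length_tail, List.length_drop] at *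
  omega

variable [DecidableEq K]

namespace Exec

variable {P : Port B}

theorem each_dropRow (s : Mem) (w : List (Option (Option Bool))) :
    Exec P (Prog.each P .diag (fun o => o.isNone) fun _ => .skip : Prog B τ) { s with diag := w }
      { s with diag := dropRow w } (2 * w.length + 1) := by
  induction w with
  | nil => exact each_nil rfl
  | cons o w ih =>
    cases o with
    | none =>
      exact (each_stop (t := .diag) (final := fun o => o.isNone) (a := none) (l := w) rfl rfl).cast
        (by simp [dropRow, Mem.setWord]) (by omega)
    | some o =>
      exact (each_cons (t := .diag) (a := some o) (l := w) rfl rfl (skip _) ih).cast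
        (by simp [dropRow]) (by simp only [List.length_cons]; omega)

/-- Stated for arbitrary words, so that no property of the answer is needed for the run. An
exhausted tape counts as a fault, in agreement with `w[a]?` being `none`. -/
theorem readAnswer_number {s s' : Mem} {T : ℕ} (a : ℕ) (l : List Letter)
    (w : List (Option (Option Bool)))
    (h : Exec P (Prog.readAnswer P : Prog B τ) { s with
      port := l
      diag := restDiag a w
      excess := (if w[a]? = some (some (some true)) then 0 else 1) + s.excess
      result := (encodeNat (diagValue a w)).reverse ++ s.result } s' T) :
    Exec P (Prog.readAnswer P : Prog B τ) { s with port := encodeNat a ++ l, diag := w } s'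
      (3 * a + 2 * w.length + 6 + T) := by
  induction a generalizing s w with
  | zero =>
    cases w with
    | nil =>
      refine (each_cons (t := .port) (a := Letter.comma) (l := l) rfl rfl
        (seq (get_nil rfl (inc _ _)) (put _ _ _)) (h.conv ?_ rfl le_rfl)).mono
        (by simp only [List.length_nil]; omega)
      simp [Mem.setCount, Mem.setWord, Mem.word, Mem.count, restDiag, dropRow, diagValue, encodeNat,
        Nat.add_comm]
    | cons o w =>
      have h₁ : Exec P (if o = some (some true) then .skip else Prog.inc .excess : Prog B τ)
          { s with port := l, diag := w }
          { s with
            port := l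
            diag := w
            excess := (if o = some (some true) then 0 else 1) + s.excess } 1 := by
        split_ifs
        · exact (skip _).cast (by simp) le_rfl
        · exact (inc _ _).cast (by simp [Mem.setCount, Mem.count, Nat.add_comm]) le_rfl
      refine (each_cons (t := .port) (a := Letter.comma) (l := l) rfl rfl
        (seq (get_cons (t := .diag) (a := o) (l := w) rfl (seq h₁ (each_dropRow { s with
          port := l
          excess := (if o = some (some true) then 0 else 1) + s.excess } w))) (put _ _ _))
        (h.conv ?_ rfl le_rfl)).mono (by simp only [List.length_cons]; omega)
      simp [Mem.setWord, Mem.word, restDiag, diagValue, encodeNat]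
  | succ a ih =>
    cases w with
    | nil =>
      refine (each_cons (t := .port) (a := Letter.stroke) (l := encodeNat a ++ l) rfl rfl
        (get_nil rfl (skip _)) (ih (s := s) [] (h.conv ?_ rfl le_rfl))).mono (by omega)
      simp [restDiag, diagValue]
    | cons o w =>
      by_cases ho : o.join.isSome = true
      · refine (each_cons (t := .port) (a := Letter.stroke) (l := encodeNat a ++ l) rfl rfl
          (get_cons (t := .diag) (a := o) (l := w) rfl ?_)
          (ih (s := { s with result := .stroke :: s.result }) w (h.conv ?_ rfl le_rfl))).mono
          (show 1 + 1 + _ + 1 ≤ _ by simp only [List.length_cons]; omega)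
        · simp only [ho, if_true]
          exact put _ _ _
        · simp [restDiag, diagValue, ho, encodeNat, replicate_append_cons, List.replicate_succ]
      · refine (each_cons (t := .port) (a := Letter.stroke) (l := encodeNat a ++ l) rfl rfl
          (get_cons (t := .diag) (a := o) (l := w) rfl ?_)
          (ih (s := s) w (h.conv ?_ rfl le_rfl))).mono
          (show 1 + 1 + _ + 1 ≤ _ by simp only [List.length_cons]; omega)
        · simp only [ho]
          exact skip _
        · simp [restDiag, diagValue, ho]

/-- The contents of the tape `diag` after reading a list of numbers. -/
def finalDiag : List ℕ → List (Option (Option Bool)) → List (Option (Option Bool))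
  | [], w => w
  | a :: l, w => finalDiag l (restDiag a w)

theorem length_finalDiag_le (l : List ℕ) (w : List (Option (Option Bool))) :
    (finalDiag l w).length ≤ w.length := by
  induction l generalizing w with
  | nil => exact le_rfl
  | cons a l ih => exact (ih _).trans (length_restDiag_le _ _)

theorem readAnswer_row (s : Mem) (l : List ℕ) (w : List (Option (Option Bool))) :
    Exec P (Prog.readAnswer P : Prog B τ) { s with port := encodeRow l, diag := w }
      { s with
        port := []
        diag := finalDiag l w
        excess := faults l w + s.excess
        result := (encodeRow (decodeList l w)).reverse ++ s.result }
      ((encodeRow l).length * (2 * w.length + 6)) := by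
  induction l generalizing s w with
  | nil =>
    refine (each_cons (t := .port) (a := Letter.semicolon) (l := []) rfl rfl
      (put _ _ _) (each_nil rfl)).cast ?_ (by simp [encodeRow])
    simp [Mem.setWord, Mem.word, encodeRow, finalDiag, faults, decodeList]
  | cons a l ih =>
    rw [show encodeRow (a :: l) = encodeNat a ++ encodeRow l by simp [encodeRow]]
    refine (readAnswer_number a _ w (ih { s with
      excess := (if w[a]? = some (some (some true)) then 0 else 1) + s.excess
      result := (encodeNat (diagValue a w)).reverse ++ s.result } (restDiag a w))).cast ?_ ?_
    · simp [finalDiag, faults, decodeList, encodeRow]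
      omega
    · have h₁ := Nat.mul_le_mul_left (encodeRow l).length
        (Nat.add_le_add_right (Nat.mul_le_mul_left 2 (length_restDiag_le a w)) 6)
      rw [List.length_append, Nat.add_mul]
      have h₂ : 3 * a + 2 * w.length + 6 ≤ (encodeNat a).length * (2 * w.length + 6) := by
        simp only [encodeNat, List.length_append, List.length_replicate, List.length_singleton]
        nlinarith
      omega

theorem clear_diag (s : Mem) (w : List (Option (Option Bool))) :
    Exec P (Prog.clear P .diag : Prog B τ) { s with diag := w } { s with diag := [] }
      (2 * w.length + 1) := by
  induction w with
  | nil => exact each_nil rfl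
  | cons a w ih =>
    exact (each_cons (t := .diag) (a := a) (l := w) rfl rfl (skip _) ih).mono
      (by simp only [List.length_cons]; omega)

theorem clear_result (s : Mem) (w : List Letter) :
    Exec P (Prog.clear P .result : Prog B τ) { s with result := w } { s with result := [] }
      (2 * w.length + 1) := by
  induction w with
  | nil => exact each_nil rfl
  | cons a w ih =>
    exact (each_cons (t := .result) (a := a) (l := w) rfl rfl (skip _) ih).mono
      (by simp only [List.length_cons]; omega)

theorem drain_skip (s : Mem) (c : Counter) (n : ℕ) :
    Exec P (Prog.drain c .skip : Prog B τ) (s.setCount n c) (s.setCount 0 c) (2 * n + 1) := by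
  induction n with
  | zero => exact drain_zero (by simp)
  | succ n ih =>
    exact (drain_succ (n := n) (by simp) ((skip _).cast (by simp) le_rfl) ih).mono (by omega)

/-- A single fault already erases the result, closing semicolon included, and the empty word is the
code of `none`. Further rounds clear an empty tape. -/
theorem drain_clear (s : Mem) (n : ℕ) (w : List Letter) :
    Exec P (Prog.drain .excess (Prog.clear P .result) : Prog B τ)
      { s with excess := n, result := w }
      { s with excess := 0, result := if n = 0 then w else [] } (n * (2 * w.length + 2) + 1) := by
  induction n generalizing w with
  | zero => exact (drain_zero rfl).cast (by simp) (by omega)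
  | succ n ih =>
    refine (drain_succ (n := n) rfl (clear_result { s with excess := n } w) (ih [])).cast
      (by simp) ?_
    have : n * 2 ≤ n * (2 * w.length + 2) := Nat.mul_le_mul_left _ (by omega)
    show 2 * w.length + 1 + (n * 2 + 1) + 1 ≤ _
    rw [Nat.add_mul n 1]
    omega

theorem each_out (s : Mem) (w : List Letter) :
    Exec P (Prog.each P .result (fun _ => false) fun a => Prog.put P .out a : Prog B τ)
      { s with result := w } { s with result := [], out := w.reverse ++ s.out }
      (2 * w.length + 1) := by
  induction w generalizing s with
  | nil => exact each_nil rfl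
  | cons a w ih =>
    exact (each_cons (t := .result) (a := a) (l := w) rfl rfl (put _ _ _)
      (ih { s with out := a :: s.out })).cast (by simp) (by simp only [List.length_cons]; omega)

theorem length_decodeList_le (l : List ℕ) (w : List (Option (Option Bool))) :
    (encodeRow (decodeList l w)).length ≤ (encodeRow l).length := by
  induction l generalizing w with
  | nil => simp [decodeList]
  | cons a l ih =>
    have h₁ : diagValue a w ≤ a := List.countP_le_length.trans (List.length_take_le _ _)
    have h₂ := ih (restDiag a w)
    simp only [decodeList, encodeRow, encodeNat, List.flatMap_cons, List.length_append,
      List.length_replicate, List.length_singleton] at *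
    omega

/-- At most one fault per number, and a number takes at least one letter; this bounds the time for
emptying `excess`. -/
theorem faults_le (l : List ℕ) (w : List (Option (Option Bool))) :
    faults l w ≤ (encodeRow l).length := by
  induction l generalizing w with
  | nil => simp [faults]
  | cons a l ih =>
    have h₂ := ih (restDiag a w)
    simp only [faults, encodeRow, encodeNat, List.flatMap_cons, List.length_append,
      List.length_replicate, List.length_singleton] at *
    split_ifs <;> omega

/-- Besides writing the output, the program must empty every other stack, as the halting
configuration demands. `H` bounds all initial contents at once. -/
theorem decodeAnswer (k o i h H : ℕ) (w : List (Option (Option Bool))) (ans : Option (List ℕ))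
    (hk : k ≤ H) (ho : o ≤ H) (hi : i ≤ H) (hh : h ≤ H) (hw : w.length ≤ H)
    (hans : (encodeAnswer ans).length ≤ H) :
    Exec P (Prog.decodeAnswer P : Prog B τ)
      { excess := k, outer := o, inner := i, high := h, diag := w, port := encodeAnswer ans }
      { out := encodeAnswer (translate k w ans) } (30 * (H + 1) ^ 2) := by
  -- Both kinds of answer lead to the same form of memory, so one analysis of the cleaning phase
  -- covers them. For `none` the port is empty and so is `result`, whatever `excess` is.
  have key : ∃ k' w' r, w'.length ≤ w.length ∧ r.length ≤ H ∧ k' ≤ 2 * H ∧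
      (if k' = 0 then r.reverse else []) = encodeAnswer (translate k w ans) ∧
      Exec P (Prog.readAnswer P : Prog B τ)
        { excess := k, outer := o, inner := i, high := h, diag := w, port := encodeAnswer ans }
        { excess := k', outer := o, inner := i, high := h, diag := w', result := r }
        (H * (2 * H + 6) + 1) := by
    cases ans with
    | none => exact ⟨k, w, [], le_rfl, by simp, by omega, by simp [translate, encodeAnswer],
        (each_nil rfl).mono (by omega)⟩
    | some l =>
      have h₁ := length_decodeList_le l w
      have h₂ := faults_le l w
      change (encodeRow l).length ≤ H at hans
      refine ⟨faults l w + k, finalDiag l w, (encodeRow (decodeList l w)).reverse,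
        length_finalDiag_le _ _, by simpa using h₁.trans hans, by omega, ?_,
        (readAnswer_row { excess := k, outer := o, inner := i, high := h } l w).cast ?_ ?_⟩
      · rw [translate]
        split_ifs <;> simp [encodeAnswer]
      · simp
      · have := Nat.mul_le_mul hans (show 2 * w.length + 6 ≤ 2 * H + 6 by omega)
        omega
  obtain ⟨k', w', r, hw', hr, hk', hout, hexec⟩ := key
  refine (seq hexec (seq (clear_diag { excess := k', outer := o, inner := i, high := h, result := r }
      w')
    (seq (drain_skip { excess := k', inner := i, high := h, result := r } .outer o)
    (seq (drain_skip { excess := k', high := h, result := r } .inner i)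
    (seq (drain_skip { excess := k', result := r } .high h)
    (seq (drain_clear {} k' r) (each_out {} _))))))).cast ?_ ?_
  · rw [← hout]
    split_ifs <;> simp
  · have h₁ : (if k' = 0 then r else []).length ≤ H := by split_ifs <;> simp [hr]
    have h₂ : k' * (2 * r.length + 2) ≤ 2 * H * (2 * H + 2) := Nat.mul_le_mul hk' (by omega)
    nlinarith

end Exec

end StackProgram

namespace StackProgram

/-! ### Lists of pairs -/

/-- Pairs are numbered row by row, so `s = u * n + v` has `divNat` equal to `u` and `modNat` equal
to `v`. -/
theorem ofFn_divNat_modNat {α : Type*} {m n : ℕ} (f : Fin m → Fin n → α) :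
    List.ofFn (fun s : Fin (m * n) => f s.divNat s.modNat) =
      (List.ofFn fun u => List.ofFn fun v => f u v).flatten := by
  rw [List.ofFn_mul]
  congr 2
  funext u
  congr 1
  funext v
  congr 1
  · refine Fin.ext ?_
    have hn : 0 < n := v.pos
    simp [Fin.divNat, Nat.add_div_of_dvd_right, hn]
  · refine Fin.ext ?_
    simp [Fin.modNat, Nat.mod_eq_of_lt v.2]

theorem ofFn_const_eq {α : Type*} (n : ℕ) (b : α) :
    (List.ofFn fun _ : Fin n => b) = List.replicate n b := List.ofFn_const n b

/-- The shape of a row of distances: constant except in the block of the `t`-th node. Induction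
peels off the first block. -/
theorem flatten_ofFn_ite {α : Type*} {q : ℕ} (m : ℕ) (t : Fin q) (R : List α) (b : α) :
    (List.ofFn fun u : Fin q => if u = t then R else List.replicate m b).flatten =
      List.replicate (t * m) b ++ R ++ List.replicate ((q - (t + 1)) * m) b := by
  induction q with
  | zero => exact t.elim0
  | succ q ih =>
    rw [List.ofFn_succ, List.flatten_cons]
    refine Fin.cases ?_ (fun t => ?_) t
    · have : (List.ofFn fun u : Fin q => if u.succ = 0 then R else List.replicate m b) =
          List.replicate q (List.replicate m b) := by
        simp only [Fin.succ_ne_zero, if_false, ofFn_const_eq]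
      rw [this]
      simp [List.flatten_replicate_replicate]
    · simp only [Fin.succ_inj, ih t]
      rw [if_neg (Fin.succ_ne_zero t).symm, Fin.val_succ, Nat.add_mul (t : ℕ) 1 m, Nat.one_mul,
        Nat.add_comm (t * m) m, List.replicate_add, Nat.add_sub_add_right]
      simp only [List.append_assoc]

theorem ofFn_val (q : ℕ) : (List.ofFn fun t : Fin q => (t : ℕ)) = List.range q := by
  refine List.ext_getElem (by simp) fun i h₁ h₂ => by simp

/-! ### The matching instance -/

open ExactMatchingInstance

variable (I : ExactMatchingInstance)

/-- The matrix of an exact matching instance. -/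
def rows : List (List (Option EdgeColor)) := List.ofFn fun u => List.ofFn fun v => I.edge u v

@[simp] theorem length_rows : (rows I).length = I.q := by simp [rows]

theorem table_eq_rows : I.table = [I.k] :: (rows I).map (List.map entry) := by
  simp [ExactMatchingInstance.table, rows, Function.comp_def]

/-- The instance of fine-balance matching which belongs to an instance of exact matching: the
treatment samples are the nodes of one side, the control samples are all pairs of nodes. -/
def bmInstance (c : ℕ) (hc : 2 ≤ c) : BMInstance c where
  n := I.q
  n' := I.q * I.q
  k₁ := I.q
  treatLevel₁ t := t
  treatLevel₂ t := if I.q ≤ t + I.k then ⟨1, hc⟩ else ⟨0, by omega⟩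
  ctrlLevel₁ s := s.modNat
  ctrlLevel₂ s := if I.edge s.divNat s.modNat = some .blue then ⟨1, hc⟩ else ⟨0, by omega⟩
  dist t s := if s.divNat = t then edgeCost (I.edge s.divNat s.modNat) else 1

theorem mapIdx_rows {α : Type*} (f : ℕ → List (Option EdgeColor) → α) :
    (rows I).mapIdx f = List.ofFn fun t : Fin I.q => f t (List.ofFn fun v => I.edge t v) := by
  refine List.ext_getElem (by simp) fun i h₁ h₂ => ?_
  simp [rows]

theorem ofFn_pairs_ite {α : Type*} (t : Fin I.q) (f : Option EdgeColor → α) (b : α) :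
    (List.ofFn fun s : Fin (I.q * I.q) =>
      if s.divNat = t then f (I.edge s.divNat s.modNat) else b) =
      List.replicate (t * I.q) b ++ (List.ofFn fun v => I.edge t v).map f ++
        List.replicate ((I.q - (t + 1)) * I.q) b := by
  rw [ofFn_divNat_modNat (fun u v => if u = t then f (I.edge u v) else b), ← flatten_ofFn_ite]
  congr 2
  funext u
  by_cases h : u = t
  · simp [h, Function.comp_def]
  · simp only [h, if_false, ofFn_const_eq]

/-- Links the two halves: the word computed by the encoder is the encoding of the abstract instance.
-/
theorem table_bmInstance (c : ℕ) (hc : 2 ≤ c) :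
    (bmInstance I c hc).table = instanceTable I.k (rows I) := by
  have h₁ : (List.ofFn fun t => ((bmInstance I c hc).treatLevel₁ t : ℕ)) = List.range I.q :=
    ofFn_val I.q
  have h₂ : (List.ofFn fun t => ((bmInstance I c hc).treatLevel₂ t : ℕ)) = demandList I.k I.q := by
    refine List.ext_getElem (by simp [demandList, bmInstance]) fun i h₁ h₂ => ?_
    simp only [bmInstance, List.getElem_ofFn, demandList, List.getElem_map, List.getElem_range]
    split_ifs <;> rfl
  have h₃ : (List.ofFn fun s => ((bmInstance I c hc).ctrlLevel₁ s : ℕ)) =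
      (List.replicate I.q (List.range I.q)).flatten := by
    refine (ofFn_divNat_modNat fun (_ v : Fin I.q) => (v : ℕ)).trans ?_
    rw [ofFn_val, ofFn_const_eq]
  have h₄ : (List.ofFn fun s => ((bmInstance I c hc).ctrlLevel₂ s : ℕ)) =
      (rows I).flatten.map colorCode := by
    rw [rows, ← ofFn_divNat_modNat, List.map_ofFn]
    refine congrArg List.ofFn (funext fun s : Fin (I.q * I.q) => ?_)
    show _ = colorCode (I.edge s.divNat s.modNat)
    by_cases h : I.edge s.divNat s.modNat = some .blue <;> simp [bmInstance, colorCode, h]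
  have h₅ : (List.ofFn fun t => List.ofFn fun s => (bmInstance I c hc).dist t s) =
      distTable (rows I) := by
    rw [distTable, mapIdx_rows, length_rows]
    exact congrArg List.ofFn (funext fun t => ofFn_pairs_ite I t edgeCost 1)
  rw [BMInstance.table, h₁, h₂, h₃, h₄, h₅, instanceTable, length_rows]
  rfl

theorem diagTable_rows : diagTable (rows I) = List.ofFn fun t : Fin I.q =>
    (List.ofFn fun s : Fin (I.q * I.q) =>
      if s.divNat = t then some (some (I.edge s.divNat s.modNat).isSome) else some none) ++ [none] := by
  rw [diagTable, mapIdx_rows, length_rows]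
  exact congrArg List.ofFn (funext fun t => by
    rw [ofFn_pairs_ite I t (fun e => some (some e.isSome)) (some none), diagRow])

/-! ### Correctness of the translation of answers -/

theorem restDiag_append {a : ℕ} {b w : List (Option (Option Bool))} (ha : a < b.length)
    (hb : ∀ o ∈ b, o.isSome) : restDiag a (b ++ [none] ++ w) = w := by
  rw [restDiag, dropRow, List.append_assoc, List.drop_append_of_le_length ha,
    List.dropWhile_append_of_pos fun o ho => hb o (List.mem_of_mem_drop ho)]
  rfl

/-- If each number points inside its row, skipping to the next end mark keeps rows and numbers in
step, so decoding acts row by row. -/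
theorem decodeList_flatten {l : List ℕ} {D : List (List (Option (Option Bool)))}
    (h : List.Forall₂ (fun a b => a < b.length ∧ ∀ o ∈ b, o.isSome) l D) :
    decodeList l (D.map (· ++ [none])).flatten = List.zipWith diagValue l D ∧
      (faults l (D.map (· ++ [none])).flatten = 0 ↔
        List.Forall₂ (fun a b => b[a]? = some (some (some true))) l D) := by
  induction h with
  | nil => simp [decodeList, faults]
  | @cons a b l D h₁ h₂ ih =>
    rw [List.map_cons, List.flatten_cons, decodeList, faults, restDiag_append h₁.1 h₁.2, ih.1,
      List.forall₂_cons, ← ih.2, List.append_assoc, List.getElem?_append_left h₁.1, diagValue,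
      List.take_append_of_le_length h₁.1.le]
    refine ⟨rfl, ?_⟩
    split_ifs with h <;> simp [h]

end StackProgram

namespace StackProgram

open ExactMatchingInstance

/-! ### Matchings and assignments -/

/-- An injective assignment lets counts over the selected control samples be taken over the
treatment samples instead. -/
theorem feasible_iff {c : ℕ} {J : BMInstance c} {a : Fin J.n → Fin J.n'} :
    J.Feasible a ↔ Function.Injective a ∧
      (∀ i, (Finset.univ.filter fun t => J.treatLevel₁ t = i).card =
        (Finset.univ.filter fun t => J.ctrlLevel₁ (a t) = i).card) ∧
      ∀ i, (Finset.univ.filter fun t => J.treatLevel₂ t = i).card =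
        (Finset.univ.filter fun t => J.ctrlLevel₂ (a t) = i).card := by
  refine and_congr_right fun ha => ?_
  simp only [BMInstance.FineBalance, Finset.filter_image, Finset.card_image_of_injective _ ha]

theorem card_filter_demand {q k : ℕ} (hk : k ≤ q) :
    (Finset.univ.filter fun t : Fin q => q ≤ t + k).card = k := by
  have h : (Finset.univ.filter fun t : Fin q => q ≤ t + k).map Fin.valEmbedding =
      Finset.Ico (q - k) q := by
    ext i
    simp only [Finset.mem_map, Finset.mem_filter, Finset.mem_univ, true_and, Fin.valEmbedding_apply,
      Finset.mem_Ico]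
    constructor
    · rintro ⟨t, ht, rfl⟩
      exact ⟨by omega, t.2⟩
    · rintro ⟨h₁, h₂⟩
      exact ⟨⟨i, h₂⟩, by simp only; omega, rfl⟩
  rw [← Finset.card_map, h, Nat.card_Ico]
  omega

/-- Balance at level `x` suffices: level `y` is the complement, and every other level is empty on
both sides. -/
theorem card_filter_ite {α β : Type*} [Fintype α] [DecidableEq β] {p p' : α → Prop}
    [DecidablePred p] [DecidablePred p'] {x y : β} (hxy : x ≠ y) :
    (∀ i, (Finset.univ.filter fun t => (if p t then x else y) = i).card =
      (Finset.univ.filter fun t => (if p' t then x else y) = i).card) ↔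
      (Finset.univ.filter p).card = (Finset.univ.filter p').card := by
  have hx : ∀ (p : α → Prop) [DecidablePred p],
      (Finset.univ.filter fun t => (if p t then x else y) = x) = Finset.univ.filter p := by
    intro p _
    ext t
    by_cases h : p t <;> simp [h, hxy.symm]
  have hy : ∀ (p : α → Prop) [DecidablePred p],
      (Finset.univ.filter fun t => (if p t then x else y) = y) =
        Finset.univ.filter fun t => ¬p t := by
    intro p _
    ext t
    by_cases h : p t <;> simp [h, hxy]
  constructor
  · intro h
    have := h x
    rwa [hx, hx] at this
  · intro h i
    by_cases h₁ : i = x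
    · subst h₁
      rwa [hx, hx]
    by_cases h₂ : i = y
    · subst h₂
      rw [hy, hy]
      have e₁ := Finset.card_filter_add_card_filter_not (s := Finset.univ) p
      have e₂ := Finset.card_filter_add_card_filter_not (s := Finset.univ) p'
      omega
    · have : ∀ (p : α → Prop) [DecidablePred p],
          (Finset.univ.filter fun t => (if p t then x else y) = i) = ∅ := by
        intro p _
        ext t
        by_cases h : p t <;> simp [h, Ne.symm h₁, Ne.symm h₂]
      rw [this, this]

/-- Every level on the left has one element, so equal counts mean that all fibres of `b` are
singletons. -/
theorem bijective_iff_card {q : ℕ} {b : Fin q → Fin q} :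
    Function.Bijective b ↔ ∀ i, (Finset.univ.filter fun t : Fin q => t = i).card =
      (Finset.univ.filter fun t => b t = i).card := by
  have h₁ : ∀ i : Fin q, (Finset.univ.filter fun t : Fin q => t = i).card = 1 := by
    intro i
    rw [Finset.filter_eq' Finset.univ i]
    simp
  simp only [h₁]
  constructor
  · intro hb i
    obtain ⟨u, hu, hu'⟩ := hb.existsUnique i
    exact (Finset.card_eq_one.2 ⟨u, by ext t; simp; exact ⟨hu' t, fun h => h ▸ hu⟩⟩).symm
  · intro h
    refine Finite.surjective_iff_bijective.1 fun i => ?_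
    obtain ⟨u, hu⟩ := Finset.card_pos.1 (by rw [← h i]; exact Nat.one_pos)
    exact ⟨u, (Finset.mem_filter.1 hu).2⟩

variable {I : ExactMatchingInstance} {c : ℕ} {hc : 2 ≤ c}

/-- The condition `k ≤ q` is essential: otherwise only `q` treatment samples have second level 1,
and balance would ask for `q` blue pairs. -/
theorem feasible_bmInstance_iff {a : Fin I.q → Fin (I.q * I.q)} (hk : I.k ≤ I.q) :
    (bmInstance I c hc).Feasible a ↔ Function.Injective a ∧
      Function.Bijective (fun t => (a t).modNat) ∧
      (Finset.univ.filter fun t => I.edge (a t).divNat (a t).modNat = some .blue).card = I.k := by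
  refine feasible_iff.trans (and_congr_right fun _ => and_congr ?_ ?_)
  · exact bijective_iff_card.symm
  · have h := card_filter_ite (p := fun t : Fin I.q => I.q ≤ t + I.k)
      (p' := fun t : Fin I.q => I.edge (a t).divNat (a t).modNat = some .blue)
      (x := (⟨1, hc⟩ : Fin c)) (y := ⟨0, by omega⟩) (by simp)
    rw [card_filter_demand hk] at h
    exact h.trans eq_comm

theorem dist_eq_zero_iff {t : Fin I.q} {s : Fin (I.q * I.q)} :
    (bmInstance I c hc).dist t s = 0 ↔
      s.divNat = t ∧ (I.edge s.divNat s.modNat).isSome = true := by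
  simp [bmInstance, edgeCost, ite_eq_iff]
  intro _
  rw [Option.isSome_iff_ne_none]

theorem isExactMatching_of_feasible {a : Fin I.q → Fin (I.q * I.q)} (hk : I.k ≤ I.q)
    (ha : (bmInstance I c hc).Feasible a) (h : ∀ t, (bmInstance I c hc).dist t (a t) = 0) :
    I.IsExactMatching fun t => (a t).modNat := by
  have h₁ : ∀ t, (a t).divNat = t := fun t => (dist_eq_zero_iff.1 (h t)).1
  have h₂ : ∀ t, (I.edge (a t).divNat (a t).modNat).isSome = true :=
    fun t => (dist_eq_zero_iff.1 (h t)).2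
  obtain ⟨-, h₃, h₄⟩ := (feasible_bmInstance_iff hk).1 ha
  simp only [h₁] at h₂ h₄
  exact ⟨h₃, fun u => Option.isSome_iff_ne_none.1 (h₂ u), h₄⟩

theorem IsExactMatching.le {b : Fin I.q → Fin I.q} (hb : I.IsExactMatching b) : I.k ≤ I.q := by
  rw [← hb.2.2]
  exact (Finset.card_le_univ _).trans (by simp)

/-- Assign to `t` the pair `(t, b t)`; the first components make this injective, and every distance
vanishes. -/
theorem exists_feasible {b : Fin I.q → Fin I.q} (hb : I.IsExactMatching b) :
    ∃ a, (bmInstance I c hc).Feasible a ∧ (bmInstance I c hc).cost a = 0 := by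
  have h : ∀ t, (finProdFinEquiv (t, b t)).divNat = t ∧ (finProdFinEquiv (t, b t)).modNat = b t :=
    fun t => Prod.ext_iff.1 (finProdFinEquiv.symm_apply_apply (t, b t))
  refine ⟨fun t => finProdFinEquiv (t, b t), (feasible_bmInstance_iff (IsExactMatching.le hb)).2
    ⟨fun t t' ht => ?_, ?_, ?_⟩, ?_⟩
  · exact (Prod.ext_iff.1 (finProdFinEquiv.injective ht)).1
  · simp only [h]
    exact hb.1
  · simp only [h]
    exact hb.2.2
  · refine Finset.sum_eq_zero fun t _ => dist_eq_zero_iff.2 ⟨(h t).1, ?_⟩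
    rw [(h t).1, (h t).2]
    exact Option.isSome_iff_ne_none.2 (hb.2.1 t)

/-- A row of the tape `diag` without the end mark. -/
def diagList (I : ExactMatchingInstance) (t : Fin I.q) : List (Option (Option Bool)) :=
  List.ofFn fun s : Fin (I.q * I.q) =>
    if s.divNat = t then some (some (I.edge s.divNat s.modNat).isSome) else some none

theorem getElem?_diagList_iff {t : Fin I.q} {s : Fin (I.q * I.q)} :
    (diagList I t)[(s : ℕ)]? = some (some (some true)) ↔ (bmInstance I c hc).dist t s = 0 := by
  rw [dist_eq_zero_iff, diagList, List.getElem?_ofFn]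
  simp [ite_eq_iff]

/-- Write `s = t * q + v`. The first `t * q` letters lie outside the block of `t` and are not
counted, the next `v` lie inside; so counting performs the reduction modulo `q`. -/
theorem diagValue_diagList {t : Fin I.q} {s : Fin (I.q * I.q)} (h : s.divNat = t) :
    diagValue s (diagList I t) = s.modNat := by
  subst h
  rw [diagList, ofFn_pairs_ite I s.divNat (fun e => some (some e.isSome)) (some none), diagValue]
  have hs : (s : ℕ) = (List.replicate (s.divNat * I.q) (some (none : Option Bool))).length +
      s.modNat := by
    rw [List.length_replicate]
    simp only [Fin.coe_divNat, Fin.coe_modNat]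
    exact (Nat.div_add_mod' _ _).symm
  rw [List.append_assoc, hs, List.take_length_add_append, List.countP_append,
    List.take_append_of_le_length (by simpa using s.modNat.2.le), List.countP_eq_zero.2 fun o ho => by
      rw [List.eq_of_mem_replicate ho]; simp,
    List.countP_eq_length.2, List.length_take]
  · simpa using (Nat.mod_lt _ s.modNat.pos).le
  · intro o ho
    obtain ⟨e, -, rfl⟩ := List.mem_map.1 (List.mem_of_mem_take ho)
    rfl

theorem forall₂_ofFn {α β : Type*} {n : ℕ} {R : α → β → Prop} {f : Fin n → α} {g : Fin n → β} :
    List.Forall₂ R (List.ofFn f) (List.ofFn g) ↔ ∀ i, R (f i) (g i) := by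
  rw [List.forall₂_iff_get]
  simp only [List.length_ofFn, List.get_eq_getElem, List.getElem_ofFn, true_and]
  exact ⟨fun h i => h i i.2 i.2, fun h i h₁ _ => h ⟨i, h₁⟩⟩

theorem zipWith_ofFn {α β γ : Type*} {n : ℕ} (F : α → β → γ) (f : Fin n → α) (g : Fin n → β) :
    List.zipWith F (List.ofFn f) (List.ofFn g) = List.ofFn fun i => F (f i) (g i) :=
  List.ext_getElem (by simp) fun i h₁ h₂ => by simp

/-- Zero faults together with `k ≤ q` mean that the given optimum has cost 0, hence is a matching.
In the other case an exact matching would give `k ≤ q` and a feasible assignment of cost 0, so the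
optimum would have had no faults. -/
theorem isAnswer_translate {ans : Option (List ℕ)} (h : (bmInstance I c hc).IsAnswer ans) :
    I.IsAnswer (translate (I.k - I.q) (diagTable (rows I)).flatten ans) := by
  cases ans with
  | none =>
    intro b hb
    obtain ⟨a, ha, -⟩ := exists_feasible (c := c) (hc := hc) hb
    exact h a ha
  | some l =>
    obtain ⟨a, ⟨ha, hopt⟩, rfl⟩ := h
    change Fin I.q → Fin (I.q * I.q) at a
    obtain ⟨h₁, h₂⟩ := decodeList_flatten (l := List.ofFn fun t => (a t : ℕ))
      (D := List.ofFn (diagList I)) (forall₂_ofFn.2 fun t => ⟨by simp [diagList], by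
        intro o ho
        obtain ⟨s, rfl⟩ := List.mem_ofFn.1 ho
        split_ifs <;> rfl⟩)
    have hD : (List.ofFn (diagList I)).map (· ++ [none]) = diagTable (rows I) := by
      rw [diagTable_rows, List.map_ofFn]
      rfl
    rw [hD] at h₁ h₂
    have h₃ : faults (List.ofFn fun t => (a t : ℕ)) (diagTable (rows I)).flatten = 0 ↔
        ∀ t, (bmInstance I c hc).dist t (a t) = 0 :=
      h₂.trans (forall₂_ofFn.trans (forall_congr' fun t => getElem?_diagList_iff))
    show I.IsAnswer (if faults (List.ofFn fun t : Fin I.q => (a t : ℕ)) (diagTable (rows I)).flatten +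
      (I.k - I.q) = 0 then some (decodeList _ _) else none)
    split_ifs with h₀
    · have hdist := h₃.1 (by omega)
      refine ⟨_, isExactMatching_of_feasible (by omega) ha hdist, ?_⟩
      refine h₁.trans ((zipWith_ofFn ..).trans (congrArg _ (funext fun t => ?_)))
      exact diagValue_diagList (dist_eq_zero_iff.1 (hdist t)).1
    · intro b hb
      obtain ⟨a', ha', hcost⟩ := exists_feasible (c := c) (hc := hc) hb
      have hle := IsExactMatching.le hb
      have hzero := Nat.le_zero.1 ((hopt a' ha').trans_eq hcost)
      have := h₃.2 fun t => Finset.sum_eq_zero_iff.1 hzero t (Finset.mem_univ _)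
      omega

end StackProgram

namespace StackProgram

/-! ### Deterministic machines -/

section Deterministic

variable {K : Type} [DecidableEq K] {Γ : K → Type} {Λ σ : Type}

theorem iterate_bind_none {α : Type*} (f : α → Option α) (n : ℕ) :
    (flip bind f)^[n] none = none := by
  induction n with
  | zero => rfl
  | succ n ih => rw [iterate_succ_apply]; exact ih

theorem coinRun_of_iterate {m : Bool → Λ → Stmt Γ Λ σ} {m₀ : Λ → Stmt Γ Λ σ} (hm : ∀ b, m b = m₀)
    {n : ℕ} {c c' : Cfg Γ Λ σ} (h : (flip bind (step m₀))^[n] (some c) = some c')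
    (hc' : c'.l = none) {coins : List Bool} (hn : n ≤ coins.length) : coinRun m coins c = c' := by
  induction n generalizing c coins with
  | zero =>
    obtain rfl := Option.some.inj h
    exact coinRun_halted _ _ _ hc'
  | succ n ih =>
    cases coins with
    | nil => simp at hn
    | cons b coins =>
      rw [iterate_succ_apply] at h
      change (flip bind (step m₀))^[n] (step m₀ c) = _ at h
      rw [coinRun_cons, hm]
      cases hs : step m₀ c with
      | none => rw [hs, iterate_bind_none] at h; cases h
      | some c₁ =>
        rw [hs] at h
        exact ih h (by simpa using hn)

/-- Coins tossed after halting change nothing but are not steps of the deterministic machine, hence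
`n` may be smaller than the number of coins. -/
theorem exists_iterate_of_coinRun {m : Bool → Λ → Stmt Γ Λ σ} {m₀ : Λ → Stmt Γ Λ σ}
    (hm : ∀ b, m b = m₀) {c c' : Cfg Γ Λ σ} {coins : List Bool} (h : coinRun m coins c = c') :
    ∃ n ≤ coins.length, (flip bind (step m₀))^[n] (some c) = some c' := by
  induction coins generalizing c with
  | nil => exact ⟨0, le_rfl, congrArg some h⟩
  | cons b coins ih =>
    rw [coinRun_cons, hm] at h
    cases hs : step m₀ c with
    | none =>
      rw [hs] at h
      obtain ⟨n, hn, h'⟩ := ih h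
      exact ⟨n, by simp; omega, h'⟩
    | some c₁ =>
      rw [hs] at h
      obtain ⟨n, hn, h'⟩ := ih h
      refine ⟨n + 1, by simpa using hn, ?_⟩
      rw [iterate_succ_apply]
      change (flip bind (step m₀))^[n] (step m₀ c) = _
      rwa [hs]

end Deterministic

/-! ### Coin tosses -/

/-- The event depends only on the coordinates in the range of `e`. Splitting off the others writes
it as a product with a full cube, whose size cancels. -/
theorem ncard_comp_mem {m n : ℕ} (e : Fin m → Fin n) (he : Injective e) (A : Set (Fin m → Bool)) :
    ({r : Fin n → Bool | r ∘ e ∈ A}.ncard : ℝ) / 2 ^ n = A.ncard / 2 ^ m := by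
  let Φ : (Fin n → Bool) ≃ (Fin m → Bool) × ({i // i ∉ Set.range e} → Bool) :=
    (Equiv.piEquivPiSubtypeProd (· ∈ Set.range e) fun _ => Bool).trans
      (Equiv.prodCongr (Equiv.arrowCongr (Equiv.ofInjective e he).symm (Equiv.refl _))
        (Equiv.refl _))
  have hΦ : ∀ r, (Φ r).1 = r ∘ e := fun r => rfl
  have h₁ : {r : Fin n → Bool | r ∘ e ∈ A} = Φ.symm '' (A ×ˢ Set.univ) := by
    rw [Equiv.image_symm_eq_preimage]
    ext r
    simp [hΦ]
  have h₂ := Nat.card_congr Φ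
  rw [Nat.card_prod] at h₂
  simp only [Nat.card_eq_fintype_card, Fintype.card_fun, Fintype.card_bool, Fintype.card_fin] at h₂
  have h₃ : (2 : ℝ) ^ n = 2 ^ m * 2 ^ Fintype.card {i // i ∉ Set.range e} := by exact_mod_cast h₂
  rw [h₁, Set.ncard_image_of_injective _ Φ.symm.injective, Set.ncard_prod, Set.ncard_univ,
    Nat.card_eq_fintype_card, Fintype.card_fun, Fintype.card_bool, h₃]
  push_cast
  exact mul_div_mul_right _ _ (by positivity)

theorem eval_mono (p : Polynomial ℕ) : Monotone fun n => p.eval n := by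
  intro a b h
  simp only [Polynomial.eval_eq_sum, Polynomial.sum]
  exact Finset.sum_le_sum fun i _ => Nat.mul_le_mul_left _ (Nat.pow_le_pow_left h i)

/-! ### The reduction -/

open ExactMatchingInstance

theorem length_le_encodeTable (l : List (List ℕ)) : l.length ≤ (encodeTable l).length := by
  induction l with
  | nil => simp
  | cons row l ih =>
    simp only [encodeTable, encodeRow, List.flatMap_cons, List.length_append, List.length_cons,
      List.length_nil] at *
    omega

instance : Fintype (Alph (.inr .inp)) := inferInstanceAs (Fintype Letter)

/-- The machine which solves the exact matching problem by a call of a machine for fine-balance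
matching. -/
def reduction (M : ProbTM2) (inAlph : M.Γ M.k₀ ≃ Letter) (outAlph : M.Γ M.k₁ ≃ Letter) : ProbTM2 :=
  composite M (A := Alph) (.inr .inp) (.inr .out) (Prog.encodeInstance ⟨M.k₀, inAlph⟩)
    (Prog.decodeAnswer ⟨M.k₁, outAlph⟩)

section

variable {K : Type} [DecidableEq K] {B : K → Type}

theorem single_nil (k : K) : single k ([] : List (B k)) = fun _ => [] := update_eq_self _ _

theorem own_inp (l : List Letter) : ({ inp := l } : Mem).own = single (B := Alph) (.inr .inp) l := by
  refine Eq.symm (update_eq_iff.2 ⟨rfl, ?_⟩)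
  rintro (c | t) h
  · cases c <;> rfl
  · cases t <;> first | rfl | exact absurd rfl h

theorem own_out (l : List Letter) : ({ out := l } : Mem).own = single (B := Alph) (.inr .out) l := by
  refine Eq.symm (update_eq_iff.2 ⟨rfl, ?_⟩)
  rintro (c | t) h
  · cases c <;> rfl
  · cases t <;> first | rfl | exact absurd rfl h

theorem length_single_le (k k' : K) (l : List (B k)) : (single k l k').length ≤ l.length := by
  by_cases h : k' = k
  · subst h; simp [single]
  · simp [single, h]

end

end StackProgram

/-! ### Running time, correctness and the two conclusions -/

namespace StackProgram

open ExactMatchingInstance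

/-- The translation of an answer for the instance of fine-balance matching into an answer for the
instance of exact matching. -/
def solution (I : ExactMatchingInstance) (ans : Option (List ℕ)) : Option (List ℕ) :=
  translate (I.k - I.q) (diagTable (rows I)).flatten ans

/-- Here the unary encoding of `k` is used; each of the `q` matrix rows contributes at least its
semicolon. -/
theorem k_q_le_length_input (I : ExactMatchingInstance) :
    I.k ≤ (ExactMatchingProblem.input I).length ∧ I.q ≤ (ExactMatchingProblem.input I).length := by
  have h₁ : ExactMatchingProblem.input I =
      encodeRow [I.k] ++ encodeTable ((rows I).map (List.map entry)) := by
    show encodeTable I.table = _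
    rw [table_eq_rows]
    rfl
  have h₂ := length_le_encodeTable ((rows I).map (List.map entry))
  rw [List.length_map, length_rows] at h₂
  have h₃ : (encodeRow [I.k]).length = I.k + 2 := by simp [encodeRow, encodeNat]
  rw [h₁, List.length_append, h₃]
  omega

/-- The time bound of the reduction: `C` bounds the growth of the stacks of the called machine in a
step, and `time` its running time. -/
noncomputable def reductionTime (C : ℕ) (time : Polynomial ℕ) : Polynomial ℕ :=
  100 * (Polynomial.X + 1) ^ 3 + time.comp (100 * (Polynomial.X + 1) ^ 3) +
    30 * (100 * (Polynomial.X + 1) ^ 3 +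
      Polynomial.C C * time.comp (100 * (Polynomial.X + 1) ^ 3) + 1) ^ 2 + 1

theorem eval_reductionTime (C : ℕ) (time : Polynomial ℕ) (N : ℕ) :
    (reductionTime C time).eval N = 100 * (N + 1) ^ 3 + time.eval (100 * (N + 1) ^ 3) +
      30 * (100 * (N + 1) ^ 3 + C * time.eval (100 * (N + 1) ^ 3) + 1) ^ 2 + 1 := by
  simp [reductionTime, Polynomial.eval_comp]

variable (M : ProbTM2) (inAlph : M.Γ M.k₀ ≃ Letter) (outAlph : M.Γ M.k₁ ≃ Letter)

/-- `C` depends only on the called machine, hence the time polynomial is uniform over instances.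
Letting the answer depend on the coins serves the randomized and the deterministic case alike. -/
theorem exists_run_reduction (time : Polynomial ℕ) :
    ∃ C : ℕ, ∀ (c : ℕ) (hc : 2 ≤ c) (I : ExactMatchingInstance)
      (f : List Bool → Option (List ℕ)),
      (∀ coins : List Bool,
        coins.length = time.eval ((BMProblem c).input (bmInstance I c hc)).length →
        M.run coins (initList M.toFinTM2
            (((BMProblem c).input (bmInstance I c hc)).map inAlph.symm)) =
          haltList M.toFinTM2 ((encodeAnswer (f coins)).map outAlph.symm)) →
      ∃ t, t + time.eval ((BMProblem c).input (bmInstance I c hc)).length ≤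
          (reductionTime C time).eval (ExactMatchingProblem.input I).length ∧
        ∀ coins : List Bool,
          coins.length = (reductionTime C time).eval (ExactMatchingProblem.input I).length →
          (reduction M inAlph outAlph).run coins
              (initList (reduction M inAlph outAlph).toFinTM2 (ExactMatchingProblem.input I)) =
            haltList (reduction M inAlph outAlph).toFinTM2 (encodeAnswer (solution I
              (f ((coins.drop t).take
                (time.eval ((BMProblem c).input (bmInstance I c hc)).length))))) := by
  have := M.ΛFin
  obtain ⟨C, hC⟩ := exists_length_coinRun_le (programs M)
  refine ⟨C, fun c hc I f hf => ?_⟩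
  obtain ⟨hk, hq⟩ := k_q_le_length_input I
  rw [eval_reductionTime]
  set N := (ExactMatchingProblem.input I).length
  have hinput : (BMProblem c).input (bmInstance I c hc) =
      encodeTable (instanceTable I.k (rows I)) := congrArg encodeTable (table_bmInstance I c hc)
  rw [hinput] at hf ⊢
  set w := encodeTable (instanceTable I.k (rows I)) with hw
  set T₁ := 100 * (N + 1) ^ 3
  have hinp : encodeTable ([I.k] :: (rows I).map (List.map entry)) = ExactMatchingProblem.input I :=
    congrArg encodeTable (table_eq_rows I).symm
  let s : Mem :=
    { excess := I.k - I.q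
      outer := I.q
      inner := I.q
      high := I.q * I.q
      diag := (diagTable (rows I)).flatten }
  have hpre : Run (τ := M.σ) (Prog.encodeInstance ⟨M.k₀, inAlph⟩)
      (merge (single (B := Alph) (.inr .inp) (ExactMatchingProblem.input I)) fun _ => [])
      (merge s.own (single M.k₀ (w.map inAlph.symm))) T₁ := by
    have h := Exec.encodeInstance (P := ⟨M.k₀, inAlph⟩) (τ := M.σ) I.k (rows I)
      (fun row h => by
        obtain ⟨u, rfl⟩ := List.mem_ofFn.1 h
        simp) N hk (by simpa using hq)
    rw [length_rows, hinp] at h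
    have h₀ : ({ inp := ExactMatchingProblem.input I } : Mem).stk ⟨M.k₀, inAlph⟩ =
        merge (single (B := Alph) (.inr .inp) (ExactMatchingProblem.input I)) fun _ => [] := by
      rw [Mem.stk, own_inp]
      exact congrArg _ (single_nil _)
    rw [Exec, h₀] at h
    refine Eq.mp (congrArg (fun S => Run _ _ (merge S _) _) ?_) h
    exact s.own_setWord_port w
  -- The length clause of `Run` now bounds the call's input and the stacks kept during the call by
  -- the encoder's time; no lengths of encodings need be computed.
  have hlen := hpre.1
  have hw' : w.length ≤ T₁ := by
    have := hlen (.inr M.k₀)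
    simpa [merge, single] using this
  have hT : time.eval w.length ≤ time.eval T₁ := eval_mono time hw'
  have hs : I.k - I.q ≤ T₁ ∧ I.q ≤ T₁ ∧ I.q * I.q ≤ T₁ ∧
      (diagTable (rows I)).flatten.length ≤ T₁ := by
    have h : ∀ k, (s.own k).length ≤ (single (B := Alph) (.inr .inp)
        (ExactMatchingProblem.input I) k).length + T₁ := fun k => hlen (.inl k)
    have h₁ := h (.inl .excess)
    have h₂ := h (.inl .outer)
    have h₃ := h (.inl .high)
    have h₄ := h (.inr .diag)
    rw [single, update_of_ne (by simp), List.length_nil, zero_add] at h₁ h₂ h₃ h₄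
    have hcount : ∀ c, (s.own (.inl c)).length = s.count c := fun c => List.length_replicate ..
    rw [hcount] at h₁ h₂ h₃
    exact ⟨h₁, h₂, h₃, h₄⟩
  set T := time.eval w.length
  set H := T₁ + C * time.eval T₁
  have hpost : ∀ coins : List Bool, coins.length = T →
      Run (τ := M.σ) (Prog.decodeAnswer ⟨M.k₁, outAlph⟩)
        (merge s.own (single M.k₁ ((encodeAnswer (f coins)).map outAlph.symm)))
        (merge (single (B := Alph) (.inr .out) (encodeAnswer (solution I (f coins)))) fun _ => [])
        (30 * (H + 1) ^ 2) := by
    intro coins hcoins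
    -- The answer fits because a stack grows by at most `C` per step from an input of length at most
    -- `T₁`.
    have hans : (encodeAnswer (f coins)).length ≤ H := by
      have h₁ := hf coins hcoins
      rw [initList_eq, haltList_eq] at h₁
      have h₂ := hC coins ⟨some M.main, M.initialState, single M.k₀ (w.map inAlph.symm)⟩ M.k₁
      have h₃ := length_single_le M.k₀ M.k₁ (w.map inAlph.symm)
      have h₄ : ((coinRun (programs M) coins
          ⟨some M.main, M.initialState, single M.k₀ (w.map inAlph.symm)⟩).stk M.k₁).length =
          (encodeAnswer (f coins)).length := by
        refine (congrArg (fun c : Cfg M.Γ M.Λ M.σ => (c.stk M.k₁).length) h₁).trans ?_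
        simp [single]
      rw [h₄, hcoins] at h₂
      have h₅ := Nat.mul_le_mul_left C hT
      rw [List.length_map] at h₃
      refine h₂.trans (Nat.add_le_add (h₃.trans hw') h₅)
    have hle : T₁ ≤ H := Nat.le_add_right _ _
    have h := Exec.decodeAnswer (P := ⟨M.k₁, outAlph⟩) (τ := M.σ) (I.k - I.q) I.q I.q (I.q * I.q) H
      (diagTable (rows I)).flatten (f coins) (hs.1.trans hle) (hs.2.1.trans hle) (hs.2.1.trans hle)
      (hs.2.2.1.trans hle) (hs.2.2.2.trans hle) hans
    have h₀ : ({ out := encodeAnswer (solution I (f coins)) } : Mem).stk ⟨M.k₁, outAlph⟩ =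
        merge (single (B := Alph) (.inr .out) (encodeAnswer (solution I (f coins))))
          fun _ => [] := by
      rw [Mem.stk, own_out]
      exact congrArg _ (single_nil _)
    rw [← solution, Exec, h₀] at h
    refine Eq.mp (congrArg (fun S => Run _ (merge S _) _ _) ?_) h
    exact s.own_setWord_port (encodeAnswer (f coins))
  obtain ⟨t, ht, hrun⟩ := exists_run_composite hpre hf hpost
  refine ⟨t, by omega, fun coins hcoins => hrun coins ?_⟩
  omega

end StackProgram

namespace StackProgram

open ExactMatchingInstance

theorem isAnswer_solution {c : ℕ} {hc : 2 ≤ c} {I : ExactMatchingInstance}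
    {ans : Option (List ℕ)} (h : (bmInstance I c hc).IsAnswer ans) : I.IsAnswer (solution I ans) :=
  isAnswer_translate h

theorem hasRandPolyTimeAlgorithm_exactMatching {c : ℕ} (hc : 2 ≤ c) {p : ℝ}
    (h : (BMProblem c).HasRandPolyTimeAlgorithm p) :
    ExactMatchingProblem.HasRandPolyTimeAlgorithm p := by
  obtain ⟨M, inAlph, outAlph, time, h⟩ := h
  obtain ⟨C, hC⟩ := exists_run_reduction M inAlph outAlph time
  refine ⟨reduction M inAlph outAlph, Equiv.refl Letter, Equiv.refl Letter, reductionTime C time,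
    fun I => ?_⟩
  have h' := h (bmInstance I c hc)
  set T := time.eval ((BMProblem c).input (bmInstance I c hc)).length with hT
  obtain ⟨f, hf, hp⟩ := h'
  -- The default value `false` is never used, since the list of coins has length exactly `T`.
  obtain ⟨t, ht, hrun⟩ := hC c hc I (fun coins => f fun i => coins.getD i false) fun coins hl => by
    have h₁ : List.ofFn (fun i : Fin T => coins.getD i false) = coins := by
      refine List.ext_getElem (by simp [hl, hT]) fun i h₁ h₂ => ?_
      simp [List.getElem?_eq_getElem h₂]
    have h₂ := hf fun i => coins.getD i false
    rw [h₁] at h₂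
    exact h₂
  set T' := (reductionTime C time).eval (ExactMatchingProblem.input I).length
  -- The window of coins read by the called machine, starting at position `t`.
  let e : Fin T → Fin T' := fun i => ⟨t + i, by have := i.2; omega⟩
  have he : Injective e := fun i j hij => by
    have : t + (i : ℕ) = t + j := congrArg Fin.val hij
    exact Fin.ext (by omega)
  refine ⟨fun r => solution I (f (r ∘ e)), fun r => ?_, ?_⟩
  · have h₁ := hrun (List.ofFn r) (List.length_ofFn ..)
    have h₂ : (fun i : Fin T => (((List.ofFn r).drop t).take T).getD i false) = r ∘ e := by
      funext i
      have hi := (e i).2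
      simp only [e] at hi
      simp [hi, e]
    beta_reduce at h₁
    refine Eq.trans ?_ (h₁.trans ?_)
    · exact congrArg (fun l => (reduction M inAlph outAlph).run (List.ofFn r)
        (initList (reduction M inAlph outAlph).toFinTM2 l)) (List.map_id _)
    · rw [h₂]
      exact congrArg (haltList (reduction M inAlph outAlph).toFinTM2) (List.map_id _).symm
  -- The event of a correct inner answer, pulled back along `e`, has the same probability and is
  -- contained in the event of a correct outer answer.
  · refine hp.trans ((ncard_comp_mem e he _).symm.le.trans ?_)
    gcongr
    · exact Set.toFinite _
    · exact fun hr => isAnswer_solution hr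

theorem hasDetPolyTimeAlgorithm_exactMatching {c : ℕ} (hc : 2 ≤ c)
    (h : (BMProblem c).HasDetPolyTimeAlgorithm) :
    ExactMatchingProblem.HasDetPolyTimeAlgorithm := by
  obtain ⟨f, hf, ⟨h⟩⟩ := h
  let M : ProbTM2 := { h.tm with m' := h.tm.m }
  have hM : ∀ b, programs M b = h.tm.m := fun b => by cases b <;> rfl
  obtain ⟨C, hC⟩ := exists_run_reduction M h.inputAlphabet h.outputAlphabet h.time
  let R := reduction M h.inputAlphabet h.outputAlphabet
  refine ⟨fun I => solution I (f (bmInstance I c hc)), fun I => isAnswer_solution (hf _), ?_⟩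
  have key : ∀ I, Nonempty (TM2OutputsInTime R.toFinTM2
      ((ExactMatchingProblem.input I).map (Equiv.refl Letter).invFun)
      (some ((encodeAnswer (solution I (f (bmInstance I c hc)))).map (Equiv.refl Letter).invFun))
      ((reductionTime C h.time).eval (ExactMatchingProblem.input I).length)) := by
    intro I
    obtain ⟨t, -, hrun⟩ := hC c hc I (fun _ => f (bmInstance I c hc)) fun coins hl =>
      coinRun_of_iterate hM (h.outputsFun (bmInstance I c hc)).evals_in_steps rfl
        ((h.outputsFun (bmInstance I c hc)).steps_le_m.trans hl.ge)
    -- Both programs agree, so any coin sequence of the right length would do.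
    have h₁ := hrun (List.replicate _ false) (List.length_replicate ..)
    have h₂ : ∀ b, programs R b =
        R.m := by
      rintro (_ | _)
      · rfl
      · exact composite_m'_eq M _ _ _ _ rfl
    obtain ⟨n, hn, h₃⟩ := exists_iterate_of_coinRun h₂ h₁
    rw [List.length_replicate] at hn
    have hid : ∀ l : List Letter, l.map (Equiv.refl Letter).invFun = l := List.map_id
    refine ⟨⟨n, ?_⟩, hn⟩
    exact (congrArg (fun l => (flip bind (step R.m))^[n] (some (initList R.toFinTM2 l)))
      (hid _)).trans (h₃.trans (congrArg (fun l => some (haltList R.toFinTM2 l)) (hid _).symm))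
  exact ⟨⟨⟨R.toFinTM2, Equiv.refl Letter,
    Equiv.refl Letter⟩, reductionTime C h.time, fun I => (key I).some⟩⟩

end StackProgram

theorem mainTheorem7 (c : ℕ) (hc : 2 ≤ c) :
    ((BMProblem c).HasDetPolyTimeAlgorithm → ExactMatchingProblem.HasDetPolyTimeAlgorithm) ∧
    (∀ p : ℝ, 0 < p → p ≤ 1 →
      (BMProblem c).HasRandPolyTimeAlgorithm p →
        ExactMatchingProblem.HasRandPolyTimeAlgorithm p) :=
  ⟨StackProgram.hasDetPolyTimeAlgorithm_exactMatching hc,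
    fun _ _ _ h => StackProgram.hasRandPolyTimeAlgorithm_exactMatching hc h⟩
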